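/- For non-negative integers $k,\lambda$, a family $\mathcal F$ of sets is called $k$-almost $\lambda$-Fisher if for every $F\in\mathcal F$ there are at most $k$ other sets $F'\in\mathcal F\setminus\{F\}$ with $|F\cap F'|\neq\lambda$. Let $$f(n,k,\lambda)=\max\{|\mathcal F| : \mathcal F\subseteq 2^{[n]} \text{ is a } k\text{-almost } \lambda\text{-Fisher family}\},\qquad [n]=\{1,\dots,n\}.$$ (i) There is an absolute constant $N$ such that for all integers $n\ge N$, $k\ge 1$ and $\lambda\ge 0$, $$f(n,k,\lambda)\le (2n-2)\left\lceil\frac{k+1}{3}\right\rceil .$$ (ii) Let $(\lambda_n)_{n\ge 0}$ be a sequence of non-negative integers with $\lambda_n=o(n)$ as $n\to\infty$. Then there is a sequence of real numbers $e_n\to 0$, not depending on $k$, such that for all sufficiently large $n$ and all integers $k\ge 1$, $$f(n,k,\lambda_n)\le \left(\frac32+e_n\right) n\left\lceil\frac{k+1}{3}\right\rceil ,$$ where "sufficiently large" depends only on the sequence $(\lambda_n)$, and not on $k$. -/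

import Mathlib

open Filter Topology Asymptotics

/-- A finite family `F` of finite sets is `k`-almost `l`-Fisher if for every `A ∈ F` there are at most
`k` other sets `B ∈ F` with `|A ∩ B| ≠ l`. -/
def IsAlmostFisher {α : Type*} [DecidableEq α] (k l : ℕ) (F : Finset (Finset α)) : Prop :=
  ∀ A ∈ F, (F.filter fun B => B ≠ A ∧ (A ∩ B).card ≠ l).card ≤ k

open Classical in
/-- `almostFisherMax n k l` is `f(n,k,l)`, the largest size of a `k`-almost `l`-Fisher family of
subsets of an `n`-element set. -/
noncomputable def almostFisherMax (n k l : ℕ) : ℕ :=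
  (Finset.univ.filter fun F : Finset (Finset (Fin n)) => IsAlmostFisher k l F).sup Finset.card

/-- The maximum defining `f(n,k,l)` is attained, and it is an upper bound. -/
theorem almostFisherMax_isGreatest (n k l : ℕ) :
    IsGreatest {m : ℕ | ∃ F : Finset (Finset (Fin n)), IsAlmostFisher k l F ∧ F.card = m}
      (almostFisherMax n k l) := by
  classical
  constructor
  · obtain ⟨F, hF, h⟩ := Finset.exists_mem_eq_sup
      (Finset.univ.filter fun F : Finset (Finset (Fin n)) => IsAlmostFisher k l F)
      ⟨∅, by simp [IsAlmostFisher]⟩ Finset.card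
    refine ⟨F, by simpa using hF, ?_⟩
    rw [almostFisherMax, ← h]
  · rintro m ⟨F, hF, rfl⟩
    exact Finset.le_sup (f := Finset.card) (by simpa using hF)

/-!
Let `A ↦ v A` be the characteristic vectors of a `2`-almost `l`-Fisher family `F` on `n` points.
The matrix `M` of the numbers `|A ∩ B| - l` is supported, off the diagonal, on a graph of maximum
degree at most two (`fisherGraph`), so it splits into blocks, one for each connected component.
Lovász's partition lemma (`exists_coloring_card_le_two`) splits a `k`-almost Fisher family into
`⌈(k+1)/3⌉` families which are `2`-almost Fisher; it remains to bound the latter.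

Let `r` be the rank of the block of a component with `s` members. A kernel vector which vanishes at
two adjacent vertices vanishes on the component, whence `s ≤ r + 2` (`card_le_finrank_add_two`).
If `M` is the Gram matrix of vectors which are nonzero zero-one vectors in suitable coordinates,
then `2 s ≤ 3 r` (`two_mul_card_le_of_zero_one`): there are at most `2 ^ r - 1` such vectors, and the
remaining case of five vectors of rank three is excluded because among five nonzero points of
`{0,1}³` one is the sum of two others.

Translate the characteristic vectors along the point `q` of minimal norm of their affine hull, and
let `μ = ⟨q, q⟩`. If `μ > l`, a translation by a multiple of `q` has Gram matrix `M`, and the original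
zero-one coordinates are linear functionals of the translated vectors, so that `2 |F| ≤ 3 n`. If
`μ < l`, the form `⟨v, v'⟩ - l t t'` has a negative vector in the span of the vectors `(v A, 1)` of
one component, and the other components are treated as before (`two_mul_card_le_of_negative`). If
`μ = l`, then `z = q` satisfies `⟨z, z⟩ = ⟨z, v A⟩ = l`, and `M` is the Gram matrix of the vectors
`v A - z`. When these are zero-one vectors the bound `2 s ≤ 3 r` applies again, but for one component
if some `v A` equals `z`; this covers the cases `z = 0` and `z = v A`. Otherwise they are nonzero, lie
in the orthogonal complement of `z`, and `s ≤ 2 r`, because `|A ∩ B| ≤ |A|` excludes three of them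
on a common line; this gives `|F| ≤ 2 (n - 1)` (`card_le_of_isotropic`).

For the second bound one counts the exceptional components, those with `2 s > 3 r`. On the zero set
of `z` the vectors `v A - z` are zero-one vectors, so the span of an exceptional component contains a
nonzero vector supported on the support of `z`. Such a component also makes `z` an affine combination
of at most five zero-one vectors, so `z` has at most `32` values. Either the span of every exceptional
component contains a nonzero function of `z`, and then there are at most `32` of them by orthogonality; or the relations in one such
component are determined by a linear system with coefficients `-1, 0, 1` and bounded size, so that
`|z|` is at least an absolute constant on its support, which thus has size `O(l)`, and there are
`O(l)` exceptional components (`card_exceptional_le`).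
-/

/-! ### Kernel vectors on a connected component of maximum degree two -/

section Kernel

variable {ι : Type*} [Fintype ι]

open Classical in
/-- The vertices of a connected component, as a finset. -/
noncomputable def compVerts (G : SimpleGraph ι) (c : G.ConnectedComponent) : Finset ι :=
  Finset.univ.filter fun i => G.connectedComponentMk i = c

/-- The graph `G` has maximum degree at most two. -/
def DegLeTwo (G : SimpleGraph ι) : Prop :=
  ∀ i a b c, G.Adj i a → G.Adj i b → G.Adj i c → a = b ∨ a = c ∨ b = c

/-- Off the diagonal, the support of the matrix `M` is the graph `G`. -/
def SupportedOn (G : SimpleGraph ι) (M : ι → ι → ℝ) : Prop :=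
  ∀ i j, i ≠ j → (M i j ≠ 0 ↔ G.Adj i j)

variable {G : SimpleGraph ι} {M : ι → ι → ℝ} {c : G.ConnectedComponent}

theorem mem_compVerts {i : ι} : i ∈ compVerts G c ↔ G.connectedComponentMk i = c := by
  simp [compVerts]

theorem compVerts_nonempty (c : G.ConnectedComponent) : (compVerts G c).Nonempty := by
  obtain ⟨i, rfl⟩ := c.exists_rep
  exact ⟨i, mem_compVerts.2 rfl⟩

theorem mem_compVerts_of_adj {i j : ι} (hi : i ∈ compVerts G c) (h : G.Adj i j) :
    j ∈ compVerts G c := by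
  rw [mem_compVerts] at *
  rw [← hi]
  exact (SimpleGraph.ConnectedComponent.sound h.reachable).symm

theorem exists_adj_of_one_lt_card (h : 1 < (compVerts G c).card) {i : ι}
    (hi : i ∈ compVerts G c) : ∃ j ∈ compVerts G c, G.Adj i j := by
  obtain ⟨j, hj, hne⟩ := Finset.exists_mem_ne h i
  have hr : G.Reachable i j := by
    apply SimpleGraph.ConnectedComponent.exact
    rw [mem_compVerts.1 hi, mem_compVerts.1 hj]
  obtain ⟨w⟩ := hr
  cases w with
  | nil => exact absurd rfl hne
  | cons h' _ => exact ⟨_, mem_compVerts_of_adj hi h', h'⟩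

/-- Three-term recurrence: in a row of a kernel equation at most three terms are nonzero, so a
kernel vector which vanishes on two adjacent vertices vanishes on the whole component. -/
theorem kernel_eq_zero (hM : SupportedOn G M) (hdeg : DegLeTwo G) {k : ι → ℝ}
    (hk : ∀ i ∈ compVerts G c, ∑ j ∈ compVerts G c, k j * M i j = 0) {a b : ι}
    (ha : a ∈ compVerts G c) (hab : G.Adj a b) (hka : k a = 0) (hkb : k b = 0) :
    ∀ i ∈ compVerts G c, k i = 0 := by
  have step : ∀ i u, i ∈ compVerts G c → (k i = 0 ∧ ∃ j, G.Adj i j ∧ k j = 0) → G.Adj i u →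
      (k u = 0 ∧ ∃ j, G.Adj u j ∧ k j = 0) := by
    rintro i u hi ⟨h0, j, hij, hj⟩ hiu
    refine ⟨?_, i, hiu.symm, h0⟩
    by_cases huj : u = j
    · rw [huj, hj]
    have hrow := hk i hi
    rw [Finset.sum_eq_single u] at hrow
    · have := (hM i u hiu.ne).2 hiu
      exact (mul_eq_zero.1 hrow).resolve_right this
    · intro t _ htu
      by_cases hti : t = i
      · rw [hti, h0, zero_mul]
      by_cases hadj : G.Adj i t
      · rcases hdeg i u j t hiu hij hadj with h | h | h
        · exact absurd h huj
        · exact absurd h.symm htu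
        · rw [← h, hj, zero_mul]
      · have : M i t = 0 := by
          by_contra hne
          exact hadj ((hM i t (Ne.symm hti)).1 hne)
        rw [this, mul_zero]
    · intro h
      exact absurd (mem_compVerts_of_adj hi hiu) h
  intro i hi
  have hr : G.Reachable a i := by
    apply SimpleGraph.ConnectedComponent.exact
    rw [mem_compVerts.1 ha, mem_compVerts.1 hi]
  obtain ⟨w⟩ := hr
  have : ∀ {x y : ι} (w : G.Walk x y), x ∈ compVerts G c → (k x = 0 ∧ ∃ j, G.Adj x j ∧ k j = 0) →
      k y = 0 := by
    intro x y w
    induction w with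
    | nil => exact fun _ h => h.1
    | cons h' _ ih => exact fun hx h => ih (mem_compVerts_of_adj hx h') (step _ _ hx h h')
  exact this w ha ⟨hka, b, hab, hkb⟩

/-- If all linear relations between the vectors `w i` of a component are kernel vectors of the
block of `M` on that component, then the component has at most two more vertices than the dimension
of the span of these vectors. -/
theorem card_le_finrank_add_two {V : Type*} [AddCommGroup V] [Module ℝ V] [FiniteDimensional ℝ V]
    (hM : SupportedOn G M) (hdeg : DegLeTwo G) (w : ι → V)
    (hrel : ∀ k : ι → ℝ, ∑ j ∈ compVerts G c, k j • w j = 0 →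
      ∀ i ∈ compVerts G c, ∑ j ∈ compVerts G c, k j * M i j = 0) :
    (compVerts G c).card ≤ Module.finrank ℝ (Submodule.span ℝ (w '' compVerts G c)) + 2 := by
  classical
  by_cases h1 : (compVerts G c).card ≤ 1
  · omega
  push Not at h1
  obtain ⟨a, ha⟩ := compVerts_nonempty c
  obtain ⟨b, hb, hab⟩ := exists_adj_of_one_lt_card h1 ha
  let T : (compVerts G c → ℝ) →ₗ[ℝ] V := Fintype.linearCombination ℝ (fun j => w j)
  have hrange : LinearMap.range T = Submodule.span ℝ (w '' compVerts G c) := by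
    rw [Fintype.range_linearCombination, Set.image_eq_range]
    rfl
  have hdim := LinearMap.finrank_range_add_finrank_ker T
  rw [hrange, Module.finrank_fintype_fun_eq_card, Fintype.card_coe] at hdim
  let ev : LinearMap.ker T →ₗ[ℝ] (ℝ × ℝ) :=
    ((LinearMap.proj ⟨a, ha⟩).prod (LinearMap.proj ⟨b, hb⟩)).comp (LinearMap.ker T).subtype
  have hev : Function.Injective ev := by
    rw [← LinearMap.ker_eq_bot, LinearMap.ker_eq_bot']
    rintro ⟨k, hkT⟩ hk0
    have hka : k ⟨a, ha⟩ = 0 := congrArg Prod.fst hk0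
    have hkb : k ⟨b, hb⟩ = 0 := congrArg Prod.snd hk0
    let k' : ι → ℝ := fun i => if h : i ∈ compVerts G c then k ⟨i, h⟩ else 0
    have hk' : ∑ j ∈ compVerts G c, k' j • w j = 0 := by
      rw [← Finset.sum_coe_sort]
      rw [LinearMap.mem_ker] at hkT
      rw [← hkT]
      simp [T, k', Fintype.linearCombination_apply]
    have := kernel_eq_zero hM hdeg (hrel k' hk') ha hab (by simp [k', ha, hka])
      (by simp [k', hb, hkb])
    ext ⟨i, hi⟩
    have := this i hi
    simpa [k', hi] using this
  have := LinearMap.finrank_le_finrank_of_injective hev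
  simp at this
  omega

end Kernel

/-! ### Separating functionals and orthogonal subspaces -/

/-- On a space of dimension at most `r`, some `r` members of a separating family of functionals
already separate. -/
theorem exists_separating_fin {V κ : Type*} [AddCommGroup V] [Module ℝ V] [FiniteDimensional ℝ V]
    [Nonempty κ] (ψ : κ → V →ₗ[ℝ] ℝ) (r : ℕ) (E : Submodule ℝ V)
    (hsep : ∀ f ∈ E, (∀ x, ψ x f = 0) → f = 0) (hr : Module.finrank ℝ E ≤ r) :
    ∃ e : Fin r → κ, ∀ f ∈ E, (∀ t, ψ (e t) f = 0) → f = 0 := by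
  induction r generalizing E with
  | zero =>
    have : E = ⊥ := Submodule.finrank_eq_zero.1 (Nat.le_zero.1 hr)
    subst this
    exact ⟨Fin.elim0, fun f hf _ => (Submodule.mem_bot ℝ).1 hf⟩
  | succ r ih =>
    by_cases hE : E = ⊥
    · subst hE
      exact ⟨fun _ => Classical.arbitrary κ, fun f hf _ => (Submodule.mem_bot ℝ).1 hf⟩
    obtain ⟨f, hf, hf0⟩ := (Submodule.ne_bot_iff E).1 hE
    obtain ⟨x, hx⟩ : ∃ x, ψ x f ≠ 0 := by
      by_contra! h
      exact hf0 (hsep f hf h)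
    have hlt : E ⊓ LinearMap.ker (ψ x) < E := by
      refine lt_of_le_of_ne inf_le_left fun h => hx ?_
      rw [← h] at hf
      exact hf.2
    have := Submodule.finrank_lt_finrank_of_lt hlt
    obtain ⟨e, he⟩ := ih (E ⊓ LinearMap.ker (ψ x)) (fun g hg => hsep g hg.1) (by omega)
    refine ⟨Fin.cons x e, fun g hg h => he g ⟨hg, ?_⟩ fun t => ?_⟩
    · simpa using h 0
    · simpa using h t.succ

theorem sum_finrank_le {V κ : Type*} [NormedAddCommGroup V] [InnerProductSpace ℝ V]
    [FiniteDimensional ℝ V] (s : Finset κ) (E : κ → Submodule ℝ V)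
    (horth : ∀ a ∈ s, ∀ b ∈ s, a ≠ b → E a ⟂ E b) (U : Submodule ℝ V) (hU : ∀ a ∈ s, E a ≤ U) :
    ∑ a ∈ s, Module.finrank ℝ (E a) ≤ Module.finrank ℝ U := by
  classical
  have key : ∑ a ∈ s, Module.finrank ℝ (E a) = Module.finrank ℝ (s.sup E : Submodule ℝ V) := by
    clear hU
    induction s using Finset.induction_on with
    | empty => rw [Finset.sum_empty, Finset.sup_empty, finrank_bot]
    | insert a s has ih =>
      rw [Finset.sum_insert has, Finset.sup_insert, ih fun x hx y hy =>
        horth x (Finset.mem_insert_of_mem hx) y (Finset.mem_insert_of_mem hy)]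
      have hort : E a ⟂ s.sup E := by
        rw [Finset.sup_eq_iSup]
        simp only [Submodule.isOrtho_iSup_right]
        intro b hb
        exact horth a (Finset.mem_insert_self a s) b (Finset.mem_insert_of_mem hb)
          (fun h => has (h ▸ hb))
      have h := Submodule.finrank_sup_add_finrank_inf_eq (E a) (s.sup E)
      rw [hort.disjoint.eq_bot, finrank_bot] at h
      omega
  rw [key]
  exact Submodule.finrank_mono (Finset.sup_le hU)

/-- Nonzero pairwise orthogonal vectors in a subspace are at most as many as its dimension. -/
theorem card_le_finrank_of_orthogonal {V κ : Type*} [NormedAddCommGroup V] [InnerProductSpace ℝ V]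
    [FiniteDimensional ℝ V] (s : Finset κ) (f : κ → V) (h0 : ∀ a ∈ s, f a ≠ 0)
    (horth : ∀ a ∈ s, ∀ b ∈ s, a ≠ b → inner ℝ (f a) (f b) = 0)
    (U : Submodule ℝ V) (hU : ∀ a ∈ s, f a ∈ U) : s.card ≤ Module.finrank ℝ U := by
  have := sum_finrank_le s (fun a => Submodule.span ℝ {f a})
    (fun a ha b hb hab => by
      rw [Submodule.isOrtho_span]
      rintro _ rfl _ rfl
      exact horth a ha b hb hab) U
    (fun a ha => by simpa using hU a ha)
  rw [Finset.sum_congr rfl fun a ha => finrank_span_singleton (h0 a ha)] at this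
  simpa using this

/-! ### Components represented by zero-one vectors -/

/-- Deleting any two points from the cube `{0,1}³` leaves two nonzero disjoint vectors together
with their sum. -/
theorem exists_disjoint_pair_avoiding : ∀ p q : Fin 3 → Bool, ∃ b c : Fin 3 → Bool,
    (∀ t, (b t && c t) = false) ∧ b ≠ (fun _ => false) ∧ c ≠ (fun _ => false) ∧
    b ≠ p ∧ b ≠ q ∧ c ≠ p ∧ c ≠ q ∧ (fun t => b t || c t) ≠ p ∧ (fun t => b t || c t) ≠ q := by
  decide

theorem exists_add_eq_of_card_eq_five (S : Finset (Fin 3 → Bool)) (h0 : (fun _ => false) ∉ S)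
    (h5 : S.card = 5) : ∃ a ∈ S, ∃ b ∈ S, ∃ c ∈ S, ∀ t, a t = (b t || c t) ∧
      (b t && c t) = false := by
  have hcard : ((Finset.univ.erase (fun _ => false)) \ S).card = 2 := by
    rw [Finset.card_sdiff_of_subset, Finset.card_erase_of_mem (Finset.mem_univ _), h5]
    · simp
    · intro x hx
      exact Finset.mem_erase.2 ⟨fun h => h0 (h ▸ hx), Finset.mem_univ _⟩
  obtain ⟨p, q, -, hpq⟩ := Finset.card_eq_two.1 hcard
  have hmem : ∀ x : Fin 3 → Bool, x ≠ (fun _ => false) → x ≠ p → x ≠ q → x ∈ S := by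
    intro x hx hxp hxq
    by_contra hxS
    have : x ∈ (Finset.univ.erase (fun _ => false)) \ S :=
      Finset.mem_sdiff.2 ⟨Finset.mem_erase.2 ⟨hx, Finset.mem_univ _⟩, hxS⟩
    rw [hpq] at this
    simp [hxp, hxq] at this
  obtain ⟨b, c, hd, hb, hc, hbp, hbq, hcp, hcq, hap, haq⟩ := exists_disjoint_pair_avoiding p q
  refine ⟨fun t => b t || c t, hmem _ ?_ hap haq, b, hmem _ hb hbp hbq, c, hmem _ hc hcp hcq,
    fun t => ⟨rfl, hd t⟩⟩
  intro h
  apply hb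
  funext t
  have := congrFun h t
  simp only [Bool.or_eq_false_iff] at this
  exact this.1

section ZeroOne

variable {ι : Type*} [Fintype ι] {G : SimpleGraph ι} {M : ι → ι → ℝ} {c : G.ConnectedComponent}
variable {V : Type*} [NormedAddCommGroup V] [InnerProductSpace ℝ V]

/-- If the vectors `y i` of a component have Gram matrix `M`, then linear relations between them
are kernel vectors of `M`. -/
theorem relation_of_gram {y : ι → V}
    (hG : ∀ i ∈ compVerts G c, ∀ j ∈ compVerts G c, inner ℝ (y i) (y j) = M i j)
    (k : ι → ℝ) (hk : ∑ j ∈ compVerts G c, k j • y j = 0) :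
    ∀ i ∈ compVerts G c, ∑ j ∈ compVerts G c, k j * M i j = 0 := by
  intro i hi
  have := congrArg (fun v => inner ℝ (y i) v) hk
  simp only [inner_sum, inner_smul_right, inner_zero_right] at this
  rw [← this]
  exact Finset.sum_congr rfl fun j hj => by rw [hG i hi j hj]

/-- A linear relation supported on a path `a - x - b` in a component of five vertices is
impossible. The other two vertices are not adjacent, since otherwise the relation would vanish;
hence each of them has its neighbours among `a` and `b`, and by the relation is adjacent to both
of them, so that `a` has degree three. -/
theorem relation_on_path_false (hM : SupportedOn G M) (hdeg : DegLeTwo G)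
    (h5 : (compVerts G c).card = 5) {x a b : ι}
    (hx : x ∈ compVerts G c) (ha : a ∈ compVerts G c) (hb : b ∈ compVerts G c)
    (hab : a ≠ b) (hxa : G.Adj x a) (hxb : G.Adj x b) {ex ea eb : ℝ}
    (hex : ex ≠ 0) (heb : eb ≠ 0)
    (hrel : ∀ i ∈ compVerts G c, ex * M i x + ea * M i a + eb * M i b = 0) : False := by
  classical
  have hsub : ({x, a, b} : Finset ι) ⊆ compVerts G c := by
    intro t ht
    simp only [Finset.mem_insert, Finset.mem_singleton] at ht
    rcases ht with rfl | rfl | rfl <;> assumption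
  have hcard : (compVerts G c \ {x, a, b}).card = 2 := by
    rw [Finset.card_sdiff_of_subset hsub, h5, Finset.card_eq_three.2 ⟨x, a, b, hxa.ne, hxb.ne,
      hab, rfl⟩]
  obtain ⟨p, q, hpq, hrest⟩ := Finset.card_eq_two.1 hcard
  have hmem : ∀ t, t ∈ compVerts G c → t = x ∨ t = a ∨ t = b ∨ t = p ∨ t = q := by
    intro t ht
    by_cases h : t ∈ ({x, a, b} : Finset ι)
    · simp only [Finset.mem_insert, Finset.mem_singleton] at h
      tauto
    · have : t ∈ compVerts G c \ {x, a, b} := Finset.mem_sdiff.2 ⟨ht, h⟩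
      rw [hrest] at this
      simp only [Finset.mem_insert, Finset.mem_singleton] at this
      tauto
  have hout : ∀ t, t = p ∨ t = q → t ∈ compVerts G c ∧ t ≠ x ∧ t ≠ a ∧ t ≠ b := by
    intro t ht
    have : t ∈ compVerts G c \ {x, a, b} := by
      rw [hrest]
      simpa using ht
    simpa using this
  have hnpq : ¬ G.Adj p q := by
    intro hadj
    obtain ⟨hpC, hpx, hpa, hpb⟩ := hout p (Or.inl rfl)
    obtain ⟨-, hqx, hqa, hqb⟩ := hout q (Or.inr rfl)
    let k : ι → ℝ := Pi.single x ex + Pi.single a ea + Pi.single b eb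
    have hk : ∀ i ∈ compVerts G c, ∑ j ∈ compVerts G c, k j * M i j = 0 := by
      intro i hi
      rw [← hrel i hi]
      simp [k, add_mul, Finset.sum_add_distrib, Pi.single_apply, ite_mul, hx, ha, hb]
    have := kernel_eq_zero hM hdeg hk hpC hadj (by simp [k, hpx, hpa, hpb])
      (by simp [k, hqx, hqa, hqb]) x hx
    exact hex (by simpa [k, hxa.ne, hxb.ne] using this)
  have hadj_a : ∀ t, t = p ∨ t = q → G.Adj a t := by
    intro t ht
    obtain ⟨htC, htx, hta, htb⟩ := hout t ht
    have hnx : ¬ G.Adj t x := by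
      intro h
      rcases hdeg _ _ _ _ hxa hxb h.symm with h' | h' | h'
      · exact hab h'
      · exact hta h'.symm
      · exact htb h'.symm
    have hMx : M t x = 0 := by
      by_contra h
      exact hnx ((hM t x htx).1 h)
    obtain ⟨j, hjC, hj⟩ := exists_adj_of_one_lt_card (by omega) htC
    have hjab : j = a ∨ j = b := by
      rcases hmem j hjC with rfl | rfl | rfl | rfl | rfl
      · exact absurd hj hnx
      · exact Or.inl rfl
      · exact Or.inr rfl
      · rcases ht with rfl | rfl
        · exact absurd rfl hj.ne
        · exact absurd hj.symm hnpq
      · rcases ht with rfl | rfl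
        · exact absurd hj hnpq
        · exact absurd rfl hj.ne
    rcases hjab with rfl | rfl
    · exact hj.symm
    · have hb' := (hM t j htb).2 hj
      have hr := hrel t htC
      rw [hMx, mul_zero, zero_add] at hr
      refine ((hM t a hta).1 fun h0 => ?_).symm
      rw [h0, mul_zero, zero_add] at hr
      exact (mul_ne_zero heb hb') hr
  rcases hdeg _ _ _ _ hxa.symm (hadj_a p (Or.inl rfl)) (hadj_a q (Or.inr rfl)) with h | h | h
  · exact (hout p (Or.inl rfl)).2.1 h.symm
  · exact (hout q (Or.inr rfl)).2.1 h.symm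
  · exact hpq h

/-- In a component of five vertices, no vector is the sum of two others: at most one pair among
the three vectors is orthogonal, so they form a path. -/
theorem add_ne_of_card_eq_five (hM : SupportedOn G M) (hdeg : DegLeTwo G) {y : ι → V}
    (hG : ∀ i ∈ compVerts G c, ∀ j ∈ compVerts G c, inner ℝ (y i) (y j) = M i j)
    (hne : ∀ i ∈ compVerts G c, y i ≠ 0) (h5 : (compVerts G c).card = 5)
    {u v w : ι} (hu : u ∈ compVerts G c) (hv : v ∈ compVerts G c) (hw : w ∈ compVerts G c)
    (hvw : v ≠ w) : y u ≠ y v + y w := by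
  intro h
  have huv : u ≠ v := by
    rintro rfl
    exact hne w hw (by simpa using h)
  have huw : u ≠ w := by
    rintro rfl
    exact hne v hv (by simpa using h)
  have hpos : ∀ i ∈ compVerts G c, M i i ≠ 0 := fun i hi h0 => hne i hi (by
    rw [← hG i hi i hi] at h0
    exact inner_self_eq_zero.1 h0)
  have hsymm : ∀ i ∈ compVerts G c, ∀ j ∈ compVerts G c, M i j = M j i := fun i hi j hj => by
    rw [← hG i hi j hj, ← hG j hj i hi, real_inner_comm]
  have hrow : ∀ i ∈ compVerts G c, M i u = M i v + M i w := fun i hi => by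
    rw [← hG i hi u hu, ← hG i hi v hv, ← hG i hi w hw, h, inner_add_right]
  have h0 : ∀ {i j}, i ≠ j → ¬ G.Adj i j → M i j = 0 := fun {i j} hij hn => by
    by_contra hc
    exact hn ((hM i j hij).1 hc)
  have ru := hrow u hu
  have rv := hrow v hv
  have rw' := hrow w hw
  have suv := hsymm u hu v hv
  have suw := hsymm u hu w hw
  have svw := hsymm v hv w hw
  have pu := hpos u hu
  have pv := hpos v hv
  have pw := hpos w hw
  by_cases auv : G.Adj u v
  · by_cases auw : G.Adj u w
    · exact relation_on_path_false hM hdeg h5 hu hv hw hvw auv auw (ex := 1) (ea := -1) (eb := -1)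
        (by norm_num) (by norm_num) fun i hi => by linarith [hrow i hi]
    · have avw : G.Adj v w := by
        by_contra hn
        have h1 := h0 hvw hn
        have h2 := h0 huw auw
        exact pw (by linarith)
      exact relation_on_path_false hM hdeg h5 hv hu hw huw auv.symm avw (ex := -1) (ea := 1)
        (eb := -1) (by norm_num) (by norm_num) fun i hi => by linarith [hrow i hi]
  · have h1 := h0 huv auv
    have auw : G.Adj u w := by
      by_contra hn
      have h2 := h0 huw hn
      exact pu (by linarith)
    have avw : G.Adj v w := by
      by_contra hn
      have h2 := h0 hvw hn
      exact pv (by linarith)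
    exact relation_on_path_false hM hdeg h5 hw hu hv huv auw.symm avw.symm (ex := -1) (ea := 1)
      (eb := -1) (by norm_num) (by norm_num) fun i hi => by linarith [hrow i hi]

/-- If separating functionals take only the values `0` and `1` on the vectors of a component,
then the component has at most `3/2` times as many vertices as its rank. Indeed the vectors are
distinct nonzero points of `{0,1}^r`, where `r` is the rank, so that there are at most `2^r - 1`
of them, and at most `r + 2`; this leaves the case of five vectors of rank three. -/
theorem two_mul_card_le_of_zero_one [FiniteDimensional ℝ V] (hM : SupportedOn G M)
    (hdeg : DegLeTwo G) {y : ι → V}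
    (hG : ∀ i ∈ compVerts G c, ∀ j ∈ compVerts G c, inner ℝ (y i) (y j) = M i j)
    (hinj : Set.InjOn y (compVerts G c)) (hne : ∀ i ∈ compVerts G c, y i ≠ 0)
    {κ : Type*} (ψ : κ → V →ₗ[ℝ] ℝ)
    (h01 : ∀ x, ∀ i ∈ compVerts G c, ψ x (y i) = 0 ∨ ψ x (y i) = 1)
    (hsep : ∀ f ∈ Submodule.span ℝ (y '' compVerts G c), (∀ x, ψ x f = 0) → f = 0) :
    2 * (compVerts G c).card ≤
      3 * Module.finrank ℝ (Submodule.span ℝ (y '' compVerts G c)) := by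
  classical
  set r := Module.finrank ℝ (Submodule.span ℝ (y '' compVerts G c)) with hr
  have hrank := card_le_finrank_add_two (c := c) hM hdeg y (relation_of_gram hG)
  rw [← hr] at hrank
  have hmem : ∀ i ∈ compVerts G c, y i ∈ Submodule.span ℝ (y '' compVerts G c) := fun i hi =>
    Submodule.subset_span ⟨i, hi, rfl⟩
  obtain ⟨i₀, hi₀⟩ := compVerts_nonempty c
  have : Nonempty κ := by
    by_contra hκ
    exact hne i₀ hi₀ (hsep _ (hmem _ hi₀) fun x => absurd ⟨x⟩ hκ)
  obtain ⟨e, he⟩ := exists_separating_fin ψ r _ hsep hr.ge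
  let g : ι → Fin r → Bool := fun i t => decide (ψ (e t) (y i) = 1)
  have hval : ∀ i ∈ compVerts G c, ∀ t, ψ (e t) (y i) = if g i t then 1 else 0 := by
    intro i hi t
    rcases h01 (e t) i hi with h | h <;> simp [g, h]
  have ginj : Set.InjOn g (compVerts G c) := by
    intro i hi j hj hij
    apply hinj hi hj
    rw [← sub_eq_zero]
    refine he _ (Submodule.sub_mem _ (hmem i hi) (hmem j hj)) fun t => ?_
    rw [map_sub, hval i hi, hval j hj, hij, sub_self]
  have g0 : ∀ i ∈ compVerts G c, g i ≠ fun _ => false := by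
    intro i hi h
    refine hne i hi (he _ (hmem i hi) fun t => ?_)
    rw [hval i hi, h]
    simp
  have himg : (compVerts G c).image g ⊆ Finset.univ.erase (fun _ => false) := by
    intro x hx
    obtain ⟨i, hi, rfl⟩ := Finset.mem_image.1 hx
    exact Finset.mem_erase.2 ⟨g0 i hi, Finset.mem_univ _⟩
  have hpow := Finset.card_le_card himg
  rw [Finset.card_image_of_injOn ginj, Finset.card_erase_of_mem (Finset.mem_univ _)] at hpow
  simp only [Finset.card_univ, Fintype.card_pi, Fintype.card_bool, Finset.prod_const,
    Fintype.card_fin] at hpow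
  by_contra! hlt
  have hr3 : r ≤ 3 := by omega
  clear_value r
  interval_cases r
  · omega
  · omega
  · omega
  · have h5 : (compVerts G c).card = 5 := by omega
    have hS : ((compVerts G c).image g).card = 5 := by
      rw [Finset.card_image_of_injOn ginj, h5]
    obtain ⟨a, ha, b, hb, d, hd, hrel⟩ := exists_add_eq_of_card_eq_five _ (fun h => by
      obtain ⟨i, hi, h'⟩ := Finset.mem_image.1 h
      exact g0 i hi h') hS
    obtain ⟨u, hu, rfl⟩ := Finset.mem_image.1 ha
    obtain ⟨v, hv, rfl⟩ := Finset.mem_image.1 hb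
    obtain ⟨w, hw, rfl⟩ := Finset.mem_image.1 hd
    refine add_ne_of_card_eq_five hM hdeg hG hne h5 hu hv hw ?_ ?_
    · rintro rfl
      apply g0 v hv
      funext t
      simpa using (hrel t).2
    · rw [← sub_eq_zero]
      refine he _ (Submodule.sub_mem _ (hmem u hu)
        (Submodule.add_mem _ (hmem v hv) (hmem w hw))) fun t => ?_
      rw [map_sub, map_add, hval u hu, hval v hv, hval w hw, (hrel t).1]
      have := (hrel t).2
      cases hgv : g v t <;> cases hgw : g w t <;> simp_all

end ZeroOne

/-! ### The point of minimal norm of an affine hull -/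

/-- The point of minimal norm in the affine hull of finitely many vectors is an affine combination
which has the same inner product with each of them. -/
theorem exists_affine_combination_inner_eq {V ι : Type*} [NormedAddCommGroup V]
    [InnerProductSpace ℝ V] [FiniteDimensional ℝ V] (s : Finset ι) (hs : s.Nonempty) (y : ι → V) :
    ∃ a : ι → ℝ, ∑ i ∈ s, a i = 1 ∧ ∀ j ∈ s,
      inner ℝ (∑ i ∈ s, a i • y i) (y j) =
        inner ℝ (∑ i ∈ s, a i • y i) (∑ i ∈ s, a i • y i) := by
  classical
  obtain ⟨i₀, hi₀⟩ := hs
  let D : Submodule ℝ V := Submodule.span ℝ (Set.range fun i : s => y i - y i₀)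
  have hproj : D.starProjection (y i₀) ∈ D := D.starProjection_apply_mem (y i₀)
  obtain ⟨b, hb⟩ := (Submodule.mem_span_range_iff_exists_fun ℝ).1 hproj
  let b' : ι → ℝ := fun i => if h : i ∈ s then b ⟨i, h⟩ else 0
  have hb' : ∑ i ∈ s, b' i • (y i - y i₀) = D.starProjection (y i₀) := by
    rw [← hb, ← Finset.sum_coe_sort]
    exact Finset.sum_congr rfl fun i _ => by simp [b']
  let a : ι → ℝ := fun i => (if i = i₀ then 1 + ∑ j ∈ s, b' j else 0) - b' i
  have ha1 : ∑ i ∈ s, a i = 1 := by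
    simp [a, Finset.sum_sub_distrib, hi₀]
  have haq : ∑ i ∈ s, a i • y i = y i₀ - D.starProjection (y i₀) := by
    rw [← hb']
    simp only [a, sub_smul, ite_smul, zero_smul, Finset.sum_sub_distrib, smul_sub,
      Finset.sum_ite_eq', hi₀, if_true, add_smul, one_smul, Finset.sum_smul]
    abel
  have horth : ∀ j ∈ s, inner ℝ (∑ i ∈ s, a i • y i) (y j) =
      inner ℝ (∑ i ∈ s, a i • y i) (y i₀) := by
    intro j hj
    rw [← sub_eq_zero, ← inner_sub_right, haq, real_inner_comm]
    exact (Submodule.mem_orthogonal D _).1 (D.sub_starProjection_mem_orthogonal (y i₀)) _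
      (Submodule.subset_span ⟨⟨j, hj⟩, rfl⟩)
  refine ⟨a, ha1, fun j hj => ?_⟩
  have : inner ℝ (∑ i ∈ s, a i • y i) (∑ j ∈ s, a j • y j) =
      inner ℝ (∑ i ∈ s, a i • y i) (y i₀) := by
    rw [inner_sum]
    simp only [inner_smul_right]
    rw [Finset.sum_congr rfl fun j hj => by rw [horth j hj], ← Finset.sum_mul, ha1, one_mul]
  rw [this, horth j hj]

/-! ### The graph and the vectors of a family of sets -/

section Family

variable {α : Type*} [DecidableEq α]

/-- The characteristic vector of a finite set. -/
noncomputable def charVec (A : Finset α) : EuclideanSpace ℝ α :=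
  WithLp.toLp 2 fun x => if x ∈ A then 1 else 0

theorem charVec_apply (A : Finset α) (x : α) : charVec A x = if x ∈ A then 1 else 0 := rfl

theorem inner_charVec [Fintype α] (A B : Finset α) : inner ℝ (charVec A) (charVec B) = ((A ∩ B).card : ℝ) := by
  simp [PiLp.inner_apply, charVec_apply, Finset.inter_comm]

theorem charVec_injective : Function.Injective (charVec (α := α)) := by
  intro A B h
  ext x
  have := congrArg (fun v : EuclideanSpace ℝ α => v x) h
  simp only [charVec_apply] at this
  by_cases hA : x ∈ A <;> by_cases hB : x ∈ B <;> simp_all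

/-- The graph on a family in which two different sets are adjacent if their intersection does not
have size `l`. -/
def fisherGraph (l : ℕ) (F : Finset (Finset α)) : SimpleGraph F where
  Adj A B := A ≠ B ∧ ((A : Finset α) ∩ B).card ≠ l
  symm := ⟨fun A B h => ⟨h.1.symm, by rw [Finset.inter_comm]; exact h.2⟩⟩
  loopless := ⟨fun A h => h.1 rfl⟩

/-- The matrix of the numbers `|A ∩ B| - l`. -/
def excess (l : ℕ) {F : Finset (Finset α)} (A B : F) : ℝ :=
  (((A : Finset α) ∩ B).card : ℝ) - l

theorem supportedOn_excess (l : ℕ) (F : Finset (Finset α)) :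
    SupportedOn (fisherGraph l F) (excess l) := by
  intro A B hAB
  simp only [excess, fisherGraph, ne_eq, sub_eq_zero, Nat.cast_inj]
  exact ⟨fun h => ⟨hAB, h⟩, fun h => h.2⟩

theorem degLeTwo_fisherGraph {l : ℕ} {F : Finset (Finset α)} (hF : IsAlmostFisher 2 l F) :
    DegLeTwo (fisherGraph l F) := by
  intro A X Y Z hX hY hZ
  by_contra! h
  have hsub : ({X.1, Y.1, Z.1} : Finset (Finset α)) ⊆
      F.filter fun B => B ≠ A.1 ∧ (A.1 ∩ B).card ≠ l := by
    intro t ht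
    simp only [Finset.mem_insert, Finset.mem_singleton] at ht
    rw [Finset.mem_filter]
    rcases ht with rfl | rfl | rfl
    · exact ⟨X.2, fun h' => hX.1 (Subtype.ext h'.symm), hX.2⟩
    · exact ⟨Y.2, fun h' => hY.1 (Subtype.ext h'.symm), hY.2⟩
    · exact ⟨Z.2, fun h' => hZ.1 (Subtype.ext h'.symm), hZ.2⟩
  have h3 : ({X.1, Y.1, Z.1} : Finset (Finset α)).card = 3 :=
    Finset.card_eq_three.2 ⟨_, _, _, fun e => h.1 (Subtype.ext e), fun e => h.2.1 (Subtype.ext e),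
      fun e => h.2.2 (Subtype.ext e), rfl⟩
  have := Finset.card_le_card hsub
  have := hF A.1 A.2
  omega

end Family

/-! ### Summation over components -/

section Sum

variable {ι : Type*} [Fintype ι]

open Classical in
/-- The finset of all connected components. -/
noncomputable def comps (G : SimpleGraph ι) : Finset G.ConnectedComponent :=
  Finset.univ.image G.connectedComponentMk

variable {G : SimpleGraph ι} {M : ι → ι → ℝ}

theorem mk_mem_comps (i : ι) : G.connectedComponentMk i ∈ comps G := by
  classical
  exact Finset.mem_image_of_mem _ (Finset.mem_univ i)

theorem mem_comps (c : G.ConnectedComponent) : c ∈ comps G := by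
  obtain ⟨i, rfl⟩ := c.exists_rep
  exact mk_mem_comps i

theorem sum_comps_eq {β : Type*} [AddCommMonoid β] (f : ι → β) :
    ∑ c ∈ comps G, ∑ i ∈ compVerts G c, f i = ∑ i, f i := by
  classical
  unfold compVerts
  convert Finset.sum_fiberwise_of_maps_to (s := Finset.univ) (t := comps G)
    (g := G.connectedComponentMk) (fun i _ => mk_mem_comps i) f using 4

theorem card_eq_sum_comps (G : SimpleGraph ι) :
    Fintype.card ι = ∑ c ∈ comps G, (compVerts G c).card := by
  have := sum_comps_eq (G := G) (fun _ => 1)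
  simpa using this.symm

theorem eq_zero_of_mem_of_mem (hM : SupportedOn G M) {c d : G.ConnectedComponent} (hcd : c ≠ d)
    {i j : ι} (hi : i ∈ compVerts G c) (hj : j ∈ compVerts G d) : M i j = 0 := by
  by_contra h
  have hij : i ≠ j := by
    rintro rfl
    exact hcd ((mem_compVerts.1 hi).symm.trans (mem_compVerts.1 hj))
  have := mem_compVerts_of_adj hi ((hM i j hij).1 h)
  exact hcd ((mem_compVerts.1 this).symm.trans (mem_compVerts.1 hj))

variable {V : Type*} [NormedAddCommGroup V] [InnerProductSpace ℝ V]

theorem span_isOrtho_span (hM : SupportedOn G M) {y : ι → V} {c d : G.ConnectedComponent}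
    (hcd : c ≠ d)
    (hG : ∀ i ∈ compVerts G c, ∀ j ∈ compVerts G d, inner ℝ (y i) (y j) = M i j) :
    Submodule.span ℝ (y '' compVerts G c) ⟂ Submodule.span ℝ (y '' compVerts G d) := by
  rw [Submodule.isOrtho_span]
  rintro _ ⟨i, hi, rfl⟩ _ ⟨j, hj, rfl⟩
  rw [hG i hi j hj, eq_zero_of_mem_of_mem hM hcd hi hj]

/-- If the vectors on a set of components have Gram matrix `M`, the ranks of the components add up
to at most the dimension of a space containing all the vectors. -/
theorem sum_finrank_comps_le [FiniteDimensional ℝ V] (hM : SupportedOn G M) {y : ι → V}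
    (s : Finset G.ConnectedComponent)
    (hG : ∀ c ∈ s, ∀ d ∈ s, ∀ i ∈ compVerts G c, ∀ j ∈ compVerts G d,
      inner ℝ (y i) (y j) = M i j)
    (U : Submodule ℝ V) (hU : ∀ c ∈ s, ∀ i ∈ compVerts G c, y i ∈ U) :
    ∑ c ∈ s, Module.finrank ℝ (Submodule.span ℝ (y '' compVerts G c)) ≤ Module.finrank ℝ U := by
  refine sum_finrank_le s _ (fun a ha b hb hab => span_isOrtho_span hM hab (hG a ha b hb)) U ?_
  intro c hc
  rw [Submodule.span_le]
  rintro _ ⟨i, hi, rfl⟩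
  exact hU c hc i hi

end Sum

/-! ### Families whose vectors have a nondegenerate Gram matrix -/

section Nondegenerate

variable {α : Type*} [DecidableEq α] {l : ℕ} {F : Finset (Finset α)}

/-- The characteristic vector of a member of the family, translated by `-u`. -/
noncomputable def shifted (u : EuclideanSpace ℝ α) (A : F) : EuclideanSpace ℝ α :=
  charVec (A : Finset α) - u

theorem shifted_injective (u : EuclideanSpace ℝ α) :
    Function.Injective (shifted (F := F) u) := fun _ _ h =>
  Subtype.ext (charVec_injective (sub_left_injective h))

variable [Fintype α]

theorem inner_shifted {u : EuclideanSpace ℝ α} {β : ℝ} (hu : inner ℝ u u = 2 * β - l) {A B : F}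
    (hA : inner ℝ u (charVec (A : Finset α)) = β) (hB : inner ℝ u (charVec (B : Finset α)) = β) :
    inner ℝ (shifted u A) (shifted u B) = excess l A B := by
  simp only [shifted, excess, inner_sub_left, inner_sub_right, hB, hu, inner_charVec,
    real_inner_comm u (charVec (A : Finset α)), hA]
  ring

/-- If some linear functional is a nonzero constant on the shifted vectors of a component, then the
characteristic vectors themselves are linear images of the shifted vectors, and their coordinates
are zero-one functionals. -/
theorem two_mul_card_le_of_inner_const (hF : IsAlmostFisher 2 l F)
    {c : (fisherGraph l F).ConnectedComponent} {u p : EuclideanSpace ℝ α} {κ : ℝ} (hκ : κ ≠ 0)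
    (hG : ∀ A ∈ compVerts _ c, ∀ B ∈ compVerts _ c,
      inner ℝ (shifted u A) (shifted u B) = excess l A B)
    (hp : ∀ A ∈ compVerts _ c, inner ℝ p (shifted u A) = κ) :
    2 * (compVerts _ c).card ≤
      3 * Module.finrank ℝ (Submodule.span ℝ (shifted u '' (compVerts _ c : Set F))) := by
  let ψ₀ : EuclideanSpace ℝ α →ₗ[ℝ] ℝ := κ⁻¹ • (innerₛₗ ℝ p)
  have hψ₀ : ∀ A ∈ compVerts _ c, ψ₀ (shifted u A) = 1 := by
    intro A hA
    simp [ψ₀, hp A hA, hκ]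
  let π : α → EuclideanSpace ℝ α →ₗ[ℝ] ℝ := fun x =>
    (EuclideanSpace.proj x : EuclideanSpace ℝ α →L[ℝ] ℝ).toLinearMap
  have hπ : ∀ x f, π x f = f x := fun x f => rfl
  let ψ : Option α → EuclideanSpace ℝ α →ₗ[ℝ] ℝ := fun o =>
    o.elim ψ₀ fun x => π x + u x • ψ₀
  refine two_mul_card_le_of_zero_one (supportedOn_excess l F) (degLeTwo_fisherGraph hF) hG
    (shifted_injective u).injOn ?_ ψ ?_ ?_
  · intro A hA h0
    have := hp A hA
    rw [h0, inner_zero_right] at this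
    exact hκ this.symm
  · rintro (_ | x) A hA
    · exact Or.inr (hψ₀ A hA)
    · have : ψ (some x) (shifted u A) = charVec (A : Finset α) x := by
        change π x (shifted u A) + u x * ψ₀ (shifted u A) = _
        rw [hψ₀ A hA, hπ]
        simp [shifted]
      rw [this, charVec_apply]
      split_ifs <;> simp
  · intro f _ hf
    have h0 : ψ₀ f = 0 := hf none
    ext x
    have : π x f + u x * ψ₀ f = 0 := hf (some x)
    rw [h0, mul_zero, add_zero, hπ] at this
    simpa using this

/-- Relations between the vectors `(charVec A, 1)` of a component lie in the kernel of the block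
of the excess matrix. -/
theorem relation_of_lifted {c : (fisherGraph l F).ConnectedComponent} (k : F → ℝ)
    (hk : ∑ B ∈ compVerts _ c, k B • ((charVec (B : Finset α), 1) : EuclideanSpace ℝ α × ℝ) = 0) :
    ∀ A ∈ compVerts _ c, ∑ B ∈ compVerts _ c, k B * excess l A B = 0 := by
  intro A _
  have h1 : ∑ B ∈ compVerts _ c, k B • charVec (B : Finset α) = 0 := by
    simpa [Prod.fst_sum] using congrArg Prod.fst hk
  have h2 : ∑ B ∈ compVerts _ c, k B = 0 := by
    simpa [Prod.snd_sum] using congrArg Prod.snd hk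
  have h3 := congrArg (fun v => inner ℝ (charVec (A : Finset α)) v) h1
  simp only [inner_sum, inner_smul_right, inner_zero_right, inner_charVec] at h3
  simp only [excess, mul_sub, Finset.sum_sub_distrib, h3, ← Finset.sum_mul, h2]
  ring

/-- If `p` has norm squared less than `l` and inner product `l` with all characteristic vectors
outside a component `c₀`, then the family has at most `(3n+7)/2` members. The form
`⟨v, v'⟩ - l t t'` is positive definite on the span of the vectors `(charVec A, 1)` outside `c₀`,
so that this span meets the span of those in `c₀` trivially. -/
theorem two_mul_card_le_of_negative (hF : IsAlmostFisher 2 l F)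
    (c₀ : (fisherGraph l F).ConnectedComponent) {p : EuclideanSpace ℝ α}
    (hpl : inner ℝ p p < (l : ℝ))
    (hp : ∀ A : F, A ∉ compVerts _ c₀ → inner ℝ p (charVec (A : Finset α)) = l) :
    2 * F.card ≤ 3 * Fintype.card α + 7 := by
  classical
  set ρ : ℝ := inner ℝ p p with hρ
  have hρ0 : 0 ≤ ρ := real_inner_self_nonneg
  have hl : (0 : ℝ) < l := hρ0.trans_lt hpl
  -- the translation vector is `u = t • p`, where `t` is the smaller root of `ρ t² - 2 l t + l`
  set s : ℝ := Real.sqrt (l ^ 2 - l * ρ) with hs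
  have hs0 : 0 ≤ s := Real.sqrt_nonneg _
  have hs2 : s ^ 2 = l ^ 2 - l * ρ := Real.sq_sqrt (by nlinarith)
  set t : ℝ := l / (l + s) with ht
  have hls : (l : ℝ) + s ≠ 0 := by positivity
  have ht0 : 0 ≤ t := by positivity
  have ht1 : t ≤ 1 := (div_le_one (by positivity)).2 (by linarith)
  have hquad : ρ * t ^ 2 = 2 * (t * l) - l := by
    rw [ht]
    field_simp
    linear_combination hs2
  have huu : inner ℝ (t • p) (t • p) = 2 * (t * l) - (l : ℝ) := by
    rw [inner_smul_left, inner_smul_right, ← hρ, ← hquad]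
    simp
    ring
  have huA : ∀ A : F, A ∉ compVerts _ c₀ →
      inner ℝ (t • p) (charVec (A : Finset α)) = t * l := fun A hA => by
    rw [inner_smul_left, hp A hA]
    simp
  have hκ : (l : ℝ) - t * ρ ≠ 0 := by nlinarith
  have hpA : ∀ A : F, A ∉ compVerts _ c₀ → inner ℝ p (shifted (t • p) A) = l - t * ρ := by
    intro A hA
    rw [shifted, inner_sub_right, hp A hA, inner_smul_right]
  have hout : ∀ c ∈ (comps (fisherGraph l F)).erase c₀, ∀ A ∈ compVerts _ c,
      A ∉ compVerts _ c₀ := by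
    intro c hc A hA hA'
    exact (Finset.mem_erase.1 hc).1 ((mem_compVerts.1 hA).symm.trans (mem_compVerts.1 hA'))
  let U : Submodule ℝ (EuclideanSpace ℝ α) :=
    Submodule.span ℝ (shifted (t • p) '' {A : F | A ∉ compVerts _ c₀})
  have hsum := sum_finrank_comps_le (supportedOn_excess l F) (y := shifted (t • p))
    ((comps (fisherGraph l F)).erase c₀)
    (fun c hc d hd A hA B hB => inner_shifted huu (huA A (hout c hc A hA)) (huA B (hout d hd B hB)))
    U (fun c hc A hA => Submodule.subset_span ⟨A, hout c hc A hA, rfl⟩)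
  have hcomp : ∀ c ∈ (comps (fisherGraph l F)).erase c₀, 2 * (compVerts _ c).card ≤
      3 * Module.finrank ℝ (Submodule.span ℝ (shifted (t • p) '' (compVerts _ c : Set F))) := fun c hc =>
    two_mul_card_le_of_inner_const hF hκ
      (fun A hA B hB => inner_shifted huu (huA A (hout c hc A hA)) (huA B (hout c hc B hB)))
      (fun A hA => hpA A (hout c hc A hA))
  have hcomp' := Finset.sum_le_sum hcomp
  rw [← Finset.mul_sum, ← Finset.mul_sum] at hcomp'
  let w : F → EuclideanSpace ℝ α × ℝ := fun A => (charVec (A : Finset α), 1)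
  let W : Submodule ℝ (EuclideanSpace ℝ α × ℝ) := Submodule.span ℝ (w '' {A | A ∉ compVerts _ c₀})
  let W₀ : Submodule ℝ (EuclideanSpace ℝ α × ℝ) := Submodule.span ℝ (w '' compVerts _ c₀)
  have hrank : (compVerts _ c₀).card ≤ Module.finrank ℝ W₀ + 2 :=
    card_le_finrank_add_two (supportedOn_excess l F) (degLeTwo_fisherGraph hF) w
      relation_of_lifted
  have hUW : Module.finrank ℝ U ≤ Module.finrank ℝ W := by
    let P : EuclideanSpace ℝ α × ℝ →ₗ[ℝ] EuclideanSpace ℝ α :=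
      LinearMap.fst ℝ _ _ - (LinearMap.snd ℝ _ _).smulRight (t • p)
    have hle : U ≤ W.map P := by
      rw [Submodule.span_le]
      rintro _ ⟨A, hA, rfl⟩
      refine ⟨w A, Submodule.subset_span ⟨A, hA, rfl⟩, ?_⟩
      simp [P, w, shifted]
    exact (Submodule.finrank_mono hle).trans (Submodule.finrank_map_le P W)
  have h0W : ∀ f ∈ W₀, ∀ A : F, A ∉ compVerts _ c₀ →
      inner ℝ f.1 (charVec (A : Finset α)) = l * f.2 := by
    intro f hf A hA
    induction hf using Submodule.span_induction with
    | mem x hx =>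
      obtain ⟨B, hB, rfl⟩ := hx
      have hA' : A ∈ compVerts (fisherGraph l F) ((fisherGraph l F).connectedComponentMk A) :=
        mem_compVerts.2 rfl
      have := eq_zero_of_mem_of_mem (supportedOn_excess l F)
        (fun h => hA (mem_compVerts.2 h.symm)) hB hA'
      simp only [excess, sub_eq_zero] at this
      simp [w, inner_charVec, this]
    | zero => simp
    | add x y _ _ hx hy =>
      simp only [Prod.fst_add, Prod.snd_add, inner_add_left, hx, hy]
      ring
    | smul a x _ hx =>
      simp only [Prod.smul_fst, Prod.smul_snd, inner_smul_left, hx, smul_eq_mul]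
      simp
      ring
  have hinf : W₀ ⊓ W = ⊥ := by
    rw [eq_bot_iff]
    rintro f ⟨hf0, hf⟩
    have h1 : ∀ g ∈ W, inner ℝ f.1 g.1 = l * f.2 * g.2 ∧ inner ℝ p g.1 = l * g.2 := by
      intro g hg
      induction hg using Submodule.span_induction with
      | mem x hx =>
        obtain ⟨B, hB, rfl⟩ := hx
        exact ⟨by simpa [w] using h0W f hf0 B hB, by simpa [w] using hp B hB⟩
      | zero => simp
      | add x y _ _ hx hy =>
        simp only [Prod.fst_add, Prod.snd_add, inner_add_right, hx, hy]
        constructor <;> ring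
      | smul a x _ hx =>
        simp only [Prod.smul_fst, Prod.smul_snd, inner_smul_right, hx, smul_eq_mul]
        constructor <;> ring
    obtain ⟨hff, hpf⟩ := h1 f hf
    have hcs := real_inner_mul_inner_self_le p f.1
    rw [hpf, hff, ← hρ] at hcs
    have hf2 : f.2 = 0 := by
      by_contra hne
      have : 0 < f.2 ^ 2 := by positivity
      have : 0 < l * f.2 ^ 2 * (l - ρ) := by
        have : 0 < l - ρ := by linarith
        positivity
      nlinarith
    have hf1 : f.1 = 0 := by
      rw [hf2, mul_zero] at hff
      exact inner_self_eq_zero.1 hff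
    exact (Submodule.mem_bot ℝ).2 (Prod.ext hf1 hf2)
  have hdim := Submodule.finrank_sup_add_finrank_inf_eq W₀ W
  rw [hinf, finrank_bot] at hdim
  have htot := Submodule.finrank_le (W₀ ⊔ W)
  rw [Module.finrank_prod, finrank_euclideanSpace, Module.finrank_self] at htot
  have hm := card_eq_sum_comps (fisherGraph l F)
  rw [Fintype.card_coe, ← Finset.add_sum_erase _ _ (mem_comps c₀)] at hm
  omega

/-- Unless some vector `z` satisfies `⟨z, z⟩ = l` and `⟨z, A⟩ = l` for all members `A`, the family
has at most `(3n+7)/2` members. The alternatives are distinguished by the norm of the point of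
minimal norm in the affine hull of the characteristic vectors. -/
theorem two_mul_card_le_or_exists_isotropic (hF : IsAlmostFisher 2 l F) :
    2 * F.card ≤ 3 * Fintype.card α + 7 ∨ ∃ z : EuclideanSpace ℝ α, inner ℝ z z = (l : ℝ) ∧
      ∀ A : F, inner ℝ z (charVec (A : Finset α)) = l := by
  classical
  rcases F.eq_empty_or_nonempty with hE | hne
  · left
    simp [hE]
  have : Nonempty F := hne.to_subtype
  obtain ⟨a, ha1, haq⟩ := exists_affine_combination_inner_eq (Finset.univ : Finset F)
    Finset.univ_nonempty (fun A => charVec (A : Finset α))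
  set q := ∑ A : F, a A • charVec (A : Finset α) with hq
  set μ : ℝ := inner ℝ q q with hμ
  have hμ0 : 0 ≤ μ := real_inner_self_nonneg
  rcases lt_trichotomy μ l with hlt | heq | hgt
  · left
    -- split `q` over the components; one of the parts has negative excess
    let P : (fisherGraph l F).ConnectedComponent → EuclideanSpace ℝ α := fun c =>
      ∑ A ∈ compVerts _ c, a A • charVec (A : Finset α)
    let τ : (fisherGraph l F).ConnectedComponent → ℝ := fun c => ∑ A ∈ compVerts _ c, a A
    have hPA : ∀ c, ∀ A : F, A ∉ compVerts _ c →
        inner ℝ (P c) (charVec (A : Finset α)) = l * τ c := by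
      intro c A hA
      simp only [P, τ, sum_inner, Finset.mul_sum]
      refine Finset.sum_congr rfl fun B hB => ?_
      have hA' : A ∈ compVerts (fisherGraph l F) ((fisherGraph l F).connectedComponentMk A) :=
        mem_compVerts.2 rfl
      have := eq_zero_of_mem_of_mem (supportedOn_excess l F)
        (fun h => hA (mem_compVerts.2 h.symm)) hB hA'
      simp only [excess, sub_eq_zero] at this
      rw [inner_smul_left, inner_charVec, this]
      simp [mul_comm]
    have hPP : ∀ c d, c ≠ d → inner ℝ (P c) (P d) = l * τ c * τ d := by
      intro c d hcd
      have : inner ℝ (P c) (P d) = ∑ A ∈ compVerts _ d, l * τ c * a A := by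
        conv_lhs => rw [show P d = ∑ A ∈ compVerts _ d, a A • charVec (A : Finset α) from rfl]
        rw [inner_sum]
        refine Finset.sum_congr rfl fun A hA => ?_
        rw [inner_smul_right, hPA c A fun hA' =>
          hcd ((mem_compVerts.1 hA').symm.trans (mem_compVerts.1 hA))]
        ring
      rw [this, ← Finset.mul_sum]
    have hqP : q = ∑ c ∈ comps (fisherGraph l F), P c := (sum_comps_eq _).symm
    have hτ : ∑ c ∈ comps (fisherGraph l F), τ c = 1 := by
      rw [← ha1]
      exact sum_comps_eq _
    have hneg : ∑ c ∈ comps (fisherGraph l F), (inner ℝ (P c) (P c) - l * τ c * τ c) < 0 := by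
      have h1 : ∑ c ∈ comps (fisherGraph l F), ∑ d ∈ comps (fisherGraph l F),
          (inner ℝ (P c) (P d) - l * τ c * τ d) = μ - l := by
        simp only [Finset.sum_sub_distrib, ← inner_sum, ← sum_inner, ← Finset.mul_sum, hτ,
          ← hqP, mul_one, ← hμ]
      have h2 : ∀ c ∈ comps (fisherGraph l F), ∑ d ∈ comps (fisherGraph l F),
          (inner ℝ (P c) (P d) - l * τ c * τ d) = inner ℝ (P c) (P c) - l * τ c * τ c := by
        intro c hc
        rw [Finset.sum_eq_single c]
        · intro d _ hd
          rw [hPP c d hd.symm, sub_self]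
        · exact fun h => absurd hc h
      rw [← Finset.sum_congr rfl h2, h1]
      linarith
    obtain ⟨c₀, -, hc₀⟩ := Finset.exists_lt_of_sum_lt (hneg.trans_eq Finset.sum_const_zero.symm)
    have hPnn : 0 ≤ inner ℝ (P c₀) (P c₀) := real_inner_self_nonneg
    have hτ0 : τ c₀ ≠ 0 := by
      intro h
      rw [h] at hc₀
      linarith
    refine two_mul_card_le_of_negative hF c₀ (p := (τ c₀)⁻¹ • P c₀) ?_ ?_
    · rw [inner_smul_left, inner_smul_right]
      have hτ2 : 0 < τ c₀ * τ c₀ := mul_self_pos.2 hτ0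
      have : inner ℝ (P c₀) (P c₀) < l * (τ c₀ * τ c₀) := by linarith
      calc _ = inner ℝ (P c₀) (P c₀) / (τ c₀ * τ c₀) := by
            simp
            field_simp
        _ < l := (div_lt_iff₀ hτ2).2 this
    · intro A hA
      rw [inner_smul_left, hPA c₀ A hA]
      simp
      field_simp
  · right
    exact ⟨q, by rw [← hμ, heq], fun A => by rw [haq A (Finset.mem_univ A), heq]⟩
  · left
    have hμpos : 0 < μ := lt_of_le_of_lt (Nat.cast_nonneg l) hgt
    -- translate by `t • q`, where `μ (2 t - t²) = l` and `t < 1`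
    set s : ℝ := Real.sqrt (1 - l / μ) with hs
    have hpos : 0 < 1 - l / μ := by
      rw [sub_pos, div_lt_one hμpos]
      exact hgt
    have hs0 : 0 < s := Real.sqrt_pos.2 hpos
    have hs2 : s ^ 2 * μ = μ - l := by
      rw [hs, Real.sq_sqrt hpos.le]
      field_simp
    set t : ℝ := 1 - s with ht
    have huu : inner ℝ (t • q) (t • q) = 2 * (t * μ) - (l : ℝ) := by
      rw [inner_smul_left, inner_smul_right, ← hμ]
      simp only [conj_trivial, ht]
      linear_combination hs2
    have huA : ∀ A : F, inner ℝ (t • q) (charVec (A : Finset α)) = t * μ := fun A => by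
      rw [inner_smul_left, haq A (Finset.mem_univ A)]
      simp
    have hκ : μ - t * μ ≠ 0 := by
      have : μ - t * μ = s * μ := by rw [ht]; ring
      rw [this]
      positivity
    have hpA : ∀ A : F, inner ℝ q (shifted (t • q) A) = μ - t * μ := by
      intro A
      rw [shifted, inner_sub_right, haq A (Finset.mem_univ A), inner_smul_right]
    have hsum := sum_finrank_comps_le (supportedOn_excess l F) (y := shifted (t • q))
      (comps (fisherGraph l F)) (fun c _ d _ A _ B _ => inner_shifted huu (huA A) (huA B))
      ⊤ (fun _ _ _ _ => Submodule.mem_top)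
    have hcomp := Finset.sum_le_sum fun c (_ : c ∈ comps (fisherGraph l F)) =>
      two_mul_card_le_of_inner_const (c := c) hF hκ
        (fun A _ B _ => inner_shifted huu (huA A) (huA B)) (fun A _ => hpA A)
    rw [← Finset.mul_sum, ← Finset.mul_sum] at hcomp
    rw [finrank_top, finrank_euclideanSpace] at hsum
    have hm := card_eq_sum_comps (fisherGraph l F)
    rw [Fintype.card_coe] at hm
    omega

end Nondegenerate

/-! ### Families with an isotropic vector -/

section Isotropic

variable {α : Type*} [DecidableEq α] {l : ℕ} {F : Finset (Finset α)}
  {z : EuclideanSpace ℝ α}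

/-- The span of the shifted vectors of a component. -/
noncomputable def compSpan (z : EuclideanSpace ℝ α) (c : (fisherGraph l F).ConnectedComponent) :
    Submodule ℝ (EuclideanSpace ℝ α) :=
  Submodule.span ℝ (shifted z '' (compVerts _ c : Set F))

theorem shifted_mem_compSpan {c : (fisherGraph l F).ConnectedComponent} {A : F}
    (hA : A ∈ compVerts _ c) : shifted z A ∈ compSpan z c :=
  Submodule.subset_span ⟨A, hA, rfl⟩

variable [Fintype α]

/-- A vector `z` with `⟨z, z⟩ = l` and `⟨z, A⟩ = l` for all members `A` of the family. In terms
of the form `⟨v, v'⟩ - l t t'`, the vector `(z, 1)` is isotropic and orthogonal to all vectors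
`(charVec A, 1)`. -/
structure IsIsotropic (l : ℕ) (F : Finset (Finset α)) (z : EuclideanSpace ℝ α) : Prop where
  self : inner ℝ z z = (l : ℝ)
  mem : ∀ A : F, inner ℝ z (charVec (A : Finset α)) = l

theorem IsIsotropic.gram (hz : IsIsotropic l F z) (A B : F) :
    inner ℝ (shifted z A) (shifted z B) = excess l A B :=
  inner_shifted (by rw [hz.self]; ring) (hz.mem A) (hz.mem B)

theorem compSpan_isOrtho (hz : IsIsotropic l F z) {c d : (fisherGraph l F).ConnectedComponent}
    (hcd : c ≠ d) : compSpan z c ⟂ compSpan z d :=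
  span_isOrtho_span (supportedOn_excess l F) hcd fun A _ B _ => hz.gram A B

theorem card_comp_le (hF : IsAlmostFisher 2 l F) (hz : IsIsotropic l F z)
    (c : (fisherGraph l F).ConnectedComponent) :
    (compVerts _ c).card ≤ Module.finrank ℝ (compSpan z c) + 2 :=
  card_le_finrank_add_two (supportedOn_excess l F) (degLeTwo_fisherGraph hF) _
    (relation_of_gram fun A _ B _ => hz.gram A B)

theorem card_comp_eq_one (hz : IsIsotropic l F z) {c : (fisherGraph l F).ConnectedComponent}
    {A : F} (hA : A ∈ compVerts _ c) (h0 : shifted z A = 0) : (compVerts _ c).card = 1 := by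
  by_contra hne
  have hpos := Finset.card_pos.2 ⟨A, hA⟩
  obtain ⟨B, -, hAB⟩ := exists_adj_of_one_lt_card (by omega) hA
  refine (supportedOn_excess l F A B hAB.ne).2 hAB ?_
  rw [← hz.gram, h0, inner_zero_left]

/-- If `z` is zero or the characteristic vector of a member, then all shifted vectors are zero-one
vectors, and every component but the one of the zero vector satisfies the bound `3/2`. -/
theorem two_mul_card_le_of_isotropic_zero_one (hF : IsAlmostFisher 2 l F) (hz : IsIsotropic l F z)
    (h : z = 0 ∨ ∃ A : F, z = charVec (A : Finset α)) :
    2 * F.card ≤ 3 * Fintype.card α + 2 := by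
  classical
  have h01 : ∀ (x : α) (B : F), shifted z B x = 0 ∨ shifted z B x = 1 := by
    intro x B
    rcases h with rfl | ⟨A, rfl⟩
    · simp only [shifted, sub_zero, charVec_apply]
      split_ifs <;> simp
    · have h1 := hz.self
      have h2 := hz.mem B
      rw [inner_charVec] at h1 h2
      have hsub : (A : Finset α) ⊆ B := by
        rw [Finset.inter_self] at h1
        have hc : ((A : Finset α) ∩ B).card = (A : Finset α).card := by
          exact_mod_cast h2.trans h1.symm
        exact Finset.inter_eq_left.1 (Finset.eq_of_subset_of_card_le Finset.inter_subset_left hc.ge)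
      simp only [shifted, PiLp.sub_apply, charVec_apply]
      by_cases hB : x ∈ (B : Finset α)
      · by_cases hA : x ∈ (A : Finset α) <;> simp [hA, hB]
      · have hA : x ∉ (A : Finset α) := fun hA => hB (hsub hA)
        simp [hA, hB]
  have hgood : ∀ c : (fisherGraph l F).ConnectedComponent,
      (∀ A ∈ compVerts _ c, shifted z A ≠ 0) →
        2 * (compVerts _ c).card ≤ 3 * Module.finrank ℝ (compSpan z c) := by
    intro c hc
    refine two_mul_card_le_of_zero_one (supportedOn_excess l F) (degLeTwo_fisherGraph hF)
      (fun A _ B _ => hz.gram A B) (shifted_injective z).injOn hc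
      (fun x : α => (EuclideanSpace.proj x : EuclideanSpace ℝ α →L[ℝ] ℝ).toLinearMap)
      (fun x A _ => h01 x A) fun f _ hf => ?_
    ext x
    exact hf x
  have hsum : ∑ c ∈ comps (fisherGraph l F), Module.finrank ℝ (compSpan z c) ≤
      Fintype.card α := by
    have := sum_finrank_comps_le (supportedOn_excess l F) (y := shifted z)
      (comps (fisherGraph l F)) (fun c _ d _ A _ B _ => hz.gram A B) ⊤
      (fun _ _ _ _ => Submodule.mem_top)
    rwa [finrank_top, finrank_euclideanSpace] at this
  have hm := card_eq_sum_comps (fisherGraph l F)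
  rw [Fintype.card_coe] at hm
  by_cases hex : ∃ A : F, shifted z A = 0
  · obtain ⟨A, hA⟩ := hex
    set c₀ := (fisherGraph l F).connectedComponentMk A with hc₀
    have hAc : A ∈ compVerts _ c₀ := mem_compVerts.2 rfl
    have h1 := card_comp_eq_one hz hAc hA
    rw [← Finset.add_sum_erase _ _ (mem_comps c₀)] at hm hsum
    have := Finset.sum_le_sum fun c (hc : c ∈ (comps (fisherGraph l F)).erase c₀) =>
      hgood c fun B hB h0 => by
        have : B = A := shifted_injective z (h0.trans hA.symm)
        subst this
        exact (Finset.mem_erase.1 hc).1 (mem_compVerts.1 hB).symm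
    rw [← Finset.mul_sum, ← Finset.mul_sum] at this
    omega
  · push Not at hex
    have := Finset.sum_le_sum fun c (_ : c ∈ comps (fisherGraph l F)) =>
      hgood c fun A _ => hex A
    rw [← Finset.mul_sum, ← Finset.mul_sum] at this
    omega

/-- Two shifted vectors on a common line point in opposite directions: otherwise
`|A ∩ B| ≤ |A|, |B|` would force them to be equal. -/
theorem mul_neg_of_shifted_eq_smul (hz : IsIsotropic l F z) {A B : F} (hAB : A ≠ B)
    {e : EuclideanSpace ℝ α} {a b : ℝ} (hA : shifted z A = a • e) (hB : shifted z B = b • e)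
    (hA0 : shifted z A ≠ 0) (hB0 : shifted z B ≠ 0) : a * b < 0 := by
  have ha : a ≠ 0 := by
    rintro rfl
    exact hA0 (by rw [hA, zero_smul])
  have hb : b ≠ 0 := by
    rintro rfl
    exact hB0 (by rw [hB, zero_smul])
  have he : 0 < inner ℝ e e := by
    refine lt_of_le_of_ne real_inner_self_nonneg fun h => hA0 ?_
    rw [hA, inner_self_eq_zero.1 h.symm, smul_zero]
  have h1 : inner ℝ (shifted z A) (shifted z B) ≤ inner ℝ (shifted z A) (shifted z A) := by
    rw [hz.gram, hz.gram, excess, excess, Finset.inter_self]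
    have := Finset.card_le_card (Finset.inter_subset_left (s₁ := A.1) (s₂ := B.1))
    have : ((A.1 ∩ B.1).card : ℝ) ≤ A.1.card := by exact_mod_cast this
    linarith
  have h2 : inner ℝ (shifted z A) (shifted z B) ≤ inner ℝ (shifted z B) (shifted z B) := by
    rw [hz.gram, hz.gram, excess, excess, Finset.inter_self]
    have := Finset.card_le_card (Finset.inter_subset_right (s₁ := A.1) (s₂ := B.1))
    have : ((A.1 ∩ B.1).card : ℝ) ≤ B.1.card := by exact_mod_cast this
    linarith
  simp only [hA, hB, inner_smul_left, inner_smul_right, conj_trivial, ← mul_assoc] at h1 h2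
  have h1' := le_of_mul_le_mul_right h1 he
  have h2' := le_of_mul_le_mul_right h2 he
  have hne : a ≠ b := by
    rintro rfl
    exact hAB (shifted_injective z (hA.trans hB.symm))
  by_contra! hpos
  have hab : 0 < a * b := lt_of_le_of_ne hpos (mul_ne_zero ha hb).symm
  have : 0 < (a - b) ^ 2 := by
    have := sub_ne_zero.2 hne
    positivity
  rcases lt_or_gt_of_ne hne with h | h
  · nlinarith [mul_pos hab (sub_pos.2 h), mul_self_pos.2 ha, mul_self_pos.2 hb]
  · nlinarith [mul_pos hab (sub_pos.2 h), mul_self_pos.2 ha, mul_self_pos.2 hb]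

/-- If no shifted vector vanishes, a component has at most twice as many members as its rank. -/
theorem card_comp_le_two_mul (hF : IsAlmostFisher 2 l F) (hz : IsIsotropic l F z)
    (h0 : ∀ A : F, shifted z A ≠ 0) (c : (fisherGraph l F).ConnectedComponent) :
    (compVerts _ c).card ≤ 2 * Module.finrank ℝ (compSpan z c) := by
  classical
  have hle := card_comp_le hF hz c
  obtain ⟨A₀, hA₀⟩ := compVerts_nonempty c
  have hpos : Module.finrank ℝ (compSpan z c) ≠ 0 := by
    intro h
    have := Submodule.finrank_eq_zero.1 h
    have hmem := shifted_mem_compSpan (z := z) hA₀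
    rw [this] at hmem
    exact h0 A₀ ((Submodule.mem_bot ℝ).1 hmem)
  by_cases h2 : 2 ≤ Module.finrank ℝ (compSpan z c)
  · omega
  have h1 : Module.finrank ℝ (compSpan z c) = 1 := by omega
  by_contra! hlt
  obtain ⟨A, hA, B, hB, D, hD, hAB, hAD, hBD⟩ :=
    Finset.two_lt_card.1 (show 2 < (compVerts _ c).card by omega)
  obtain ⟨e, -, he⟩ := finrank_eq_one_iff'.1 h1
  obtain ⟨a, ha⟩ := he ⟨_, shifted_mem_compSpan hA⟩
  obtain ⟨b, hb⟩ := he ⟨_, shifted_mem_compSpan hB⟩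
  obtain ⟨d, hd⟩ := he ⟨_, shifted_mem_compSpan hD⟩
  have ha' : shifted z A = a • (e : EuclideanSpace ℝ α) := (congrArg Subtype.val ha).symm
  have hb' : shifted z B = b • (e : EuclideanSpace ℝ α) := (congrArg Subtype.val hb).symm
  have hd' : shifted z D = d • (e : EuclideanSpace ℝ α) := (congrArg Subtype.val hd).symm
  have n1 := mul_neg_of_shifted_eq_smul hz hAB ha' hb' (h0 A) (h0 B)
  have n2 := mul_neg_of_shifted_eq_smul hz hAD ha' hd' (h0 A) (h0 D)
  have n3 := mul_neg_of_shifted_eq_smul hz hBD hb' hd' (h0 B) (h0 D)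
  nlinarith [mul_pos_of_neg_of_neg n1 n2, sq_nonneg (a * b * d), mul_neg_of_pos_of_neg
    (mul_pos_of_neg_of_neg n1 n2) n3]

theorem card_le_of_isotropic (hF : IsAlmostFisher 2 l F) (hz : IsIsotropic l F z)
    (hz0 : z ≠ 0) (h0 : ∀ A : F, shifted z A ≠ 0) :
    F.card + 2 ≤ 2 * Fintype.card α := by
  have hsum : ∑ c ∈ comps (fisherGraph l F), Module.finrank ℝ (compSpan z c) ≤
      Module.finrank ℝ (Submodule.span ℝ {z})ᗮ := sum_finrank_comps_le (supportedOn_excess l F)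
    (y := shifted z) (comps (fisherGraph l F)) (fun c _ d _ A _ B _ => hz.gram A B) _
    (fun c _ A _ => by
      rw [Submodule.mem_orthogonal_singleton_iff_inner_right, shifted, inner_sub_right, hz.mem,
        hz.self, sub_self])
  have hdim := Submodule.finrank_add_finrank_orthogonal (Submodule.span ℝ {z})
  rw [finrank_span_singleton hz0, finrank_euclideanSpace] at hdim
  have hc := Finset.sum_le_sum fun c (_ : c ∈ comps (fisherGraph l F)) =>
    card_comp_le_two_mul hF hz h0 c
  rw [← Finset.mul_sum] at hc
  have hm := card_eq_sum_comps (fisherGraph l F)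
  rw [Fintype.card_coe] at hm
  omega

end Isotropic

/-! ### Exceptional components -/

/-- A number `ε` is a gap if every `3 × 5` linear system with coefficients in `{-1, 0, 1}` which
has a solution with coordinate sum one has such a solution whose partial sums all vanish or have
absolute value at least `ε`. -/
def IsGap (ε : ℝ) : Prop :=
  ∀ d : Fin 5 → Fin 3 → ℝ, (∀ i t, d i t ∈ ({-1, 0, 1} : Set ℝ)) →
    (∃ k : Fin 5 → ℝ, ∑ i, k i = 1 ∧ ∀ t, ∑ i, k i * d i t = 0) →
    ∃ k : Fin 5 → ℝ, (∑ i, k i = 1 ∧ ∀ t, ∑ i, k i * d i t = 0) ∧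
      ∀ S : Finset (Fin 5), ∑ i ∈ S, k i = 0 ∨ ε ≤ |∑ i ∈ S, k i|

theorem exists_uniform_pos {β : Type*} {s : Set β} (hs : s.Finite) (P : β → ℝ → Prop)
    (hanti : ∀ b ε δ, δ ≤ ε → P b ε → P b δ) (h : ∀ b ∈ s, ∃ ε > 0, P b ε) :
    ∃ ε > 0, ∀ b ∈ s, P b ε := by
  induction s, hs using Set.Finite.induction_on with
  | empty => exact ⟨1, one_pos, by simp⟩
  | @insert a s _ _ ih =>
    obtain ⟨ε, hε, h1⟩ := ih fun b hb => h b (Set.mem_insert_of_mem a hb)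
    obtain ⟨δ, hδ, h2⟩ := h a (Set.mem_insert a s)
    refine ⟨min ε δ, lt_min hε hδ, fun b hb => ?_⟩
    rcases hb with rfl | hb
    · exact hanti _ _ _ (min_le_right _ _) h2
    · exact hanti _ _ _ (min_le_left _ _) (h1 b hb)

/-- There is a positive gap, because there are only finitely many systems. -/
theorem exists_isGap : ∃ ε > 0, IsGap ε := by
  have hfin : {d : Fin 5 → Fin 3 → ℝ | ∀ i t, d i t ∈ ({-1, 0, 1} : Set ℝ)}.Finite :=
    Set.Finite.pi' fun _ => Set.Finite.pi' fun _ => Set.toFinite _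
  refine exists_uniform_pos hfin (fun d ε =>
    (∃ k : Fin 5 → ℝ, ∑ i, k i = 1 ∧ ∀ t, ∑ i, k i * d i t = 0) →
    ∃ k : Fin 5 → ℝ, (∑ i, k i = 1 ∧ ∀ t, ∑ i, k i * d i t = 0) ∧
      ∀ S : Finset (Fin 5), ∑ i ∈ S, k i = 0 ∨ ε ≤ |∑ i ∈ S, k i|) ?_ ?_
  · intro d ε δ hδ h hk
    obtain ⟨k, hk, hS⟩ := h hk
    exact ⟨k, hk, fun S => (hS S).imp_right hδ.trans⟩
  · intro d _
    by_cases hk : ∃ k : Fin 5 → ℝ, ∑ i, k i = 1 ∧ ∀ t, ∑ i, k i * d i t = 0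
    · obtain ⟨k, hk⟩ := hk
      obtain ⟨ε, hε, hS⟩ := exists_uniform_pos (Set.toFinite (Set.univ : Set (Finset (Fin 5))))
        (fun S ε => ∑ i ∈ S, k i = 0 ∨ ε ≤ |∑ i ∈ S, k i|)
        (fun S ε δ hδ h => h.imp_right hδ.trans) (fun S _ => by
          by_cases h0 : ∑ i ∈ S, k i = 0
          · exact ⟨1, one_pos, Or.inl h0⟩
          · exact ⟨_, abs_pos.2 h0, Or.inr le_rfl⟩)
      exact ⟨ε, hε, fun _ => ⟨k, hk, fun S => hS S (Set.mem_univ S)⟩⟩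
    · exact ⟨1, one_pos, fun h => absurd h hk⟩

theorem finrank_le_card_of_eq_zero {α κ : Type*} [Fintype α] [Fintype κ]
    (U : Submodule ℝ (EuclideanSpace ℝ α)) (x : κ → α)
    (hx : ∀ f ∈ U, (∀ t, f (x t) = 0) → f = 0) : Module.finrank ℝ U ≤ Fintype.card κ := by
  let L : U →ₗ[ℝ] (κ → ℝ) := LinearMap.pi fun t =>
    (EuclideanSpace.proj (x t) : EuclideanSpace ℝ α →L[ℝ] ℝ).toLinearMap.comp U.subtype
  have hL : Function.Injective L := by
    rw [← LinearMap.ker_eq_bot, LinearMap.ker_eq_bot']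
    rintro ⟨f, hf⟩ h
    exact Subtype.ext (hx f hf fun t => congrFun h t)
  have := LinearMap.finrank_le_finrank_of_injective hL
  rwa [Module.finrank_fintype_fun_eq_card] at this

section Exceptional

variable {α : Type*} [DecidableEq α] {l : ℕ} {F : Finset (Finset α)}
  {z : EuclideanSpace ℝ α} {c : (fisherGraph l F).ConnectedComponent}

/-- A component is exceptional if it has more than `3/2` times as many members as its rank. -/
def IsExceptional (z : EuclideanSpace ℝ α) (c : (fisherGraph l F).ConnectedComponent) : Prop :=
  3 * Module.finrank ℝ (compSpan z c) < 2 * (compVerts _ c).card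

/-- The span of the shifted vectors contains a nonzero vector which depends only on the value
of `z`. -/
def IsFlat (z : EuclideanSpace ℝ α) (c : (fisherGraph l F).ConnectedComponent) : Prop :=
  ∃ f ∈ compSpan z c, f ≠ 0 ∧ ∀ x x', z x = z x' → f x = f x'

theorem eq_sum_charVec {e : Fin 5 → F} {k : Fin 5 → ℝ} (hk1 : ∑ i, k i = 1)
    (hk : ∑ i, k i • shifted z (e i) = 0) (x : α) :
    z x = ∑ i, k i * charVec (e i : Finset α) x := by
  have h := congrArg (fun f : EuclideanSpace ℝ α => f x) hk
  simp only [shifted, smul_sub, Finset.sum_sub_distrib, ← Finset.sum_smul, hk1, one_smul,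
    PiLp.sub_apply, PiLp.zero_apply, sub_eq_zero] at h
  rw [← h]
  simp

variable [Fintype α]

/-- Where `z` vanishes, the shifted vectors are zero-one vectors; so in an exceptional component the
restriction to this set of coordinates is not injective. -/
theorem exists_mem_compSpan_vanishing (hF : IsAlmostFisher 2 l F) (hz : IsIsotropic l F z)
    (h0 : ∀ A : F, shifted z A ≠ 0) (hc : IsExceptional z c) :
    ∃ f ∈ compSpan z c, f ≠ 0 ∧ ∀ x, z x = 0 → f x = 0 := by
  by_contra! hcon
  refine absurd hc (not_lt.2 ?_)
  refine two_mul_card_le_of_zero_one (supportedOn_excess l F) (degLeTwo_fisherGraph hF)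
    (fun A _ B _ => hz.gram A B) (shifted_injective z).injOn (fun A _ => h0 A)
    (fun x : {x // z x = 0} =>
      (EuclideanSpace.proj x.1 : EuclideanSpace ℝ α →L[ℝ] ℝ).toLinearMap) ?_ ?_
  · rintro ⟨x, hx⟩ A _
    change shifted z A x = 0 ∨ shifted z A x = 1
    simp only [shifted, PiLp.sub_apply, hx, sub_zero, charVec_apply]
    split_ifs <;> simp
  · intro f hf hfx
    by_contra hne
    obtain ⟨x, hx, hfx'⟩ := hcon f hf hne
    exact hfx' (hfx ⟨x, hx⟩)

/-- An exceptional component has at most five members, and zero is an affine combination of its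
shifted vectors. -/
theorem exists_enumeration (hF : IsAlmostFisher 2 l F) (hz : IsIsotropic l F z)
    (hc : IsExceptional z c) :
    Module.finrank ℝ (compSpan z c) ≤ 3 ∧ ∃ e : Fin 5 → F, (∀ i, e i ∈ compVerts _ c) ∧
      ∃ k : Fin 5 → ℝ, ∑ i, k i = 1 ∧ ∑ i, k i • shifted z (e i) = 0 := by
  classical
  have hle := card_comp_le hF hz c
  unfold IsExceptional at hc
  refine ⟨by omega, ?_⟩
  have : Nonempty (compVerts _ c) := (compVerts_nonempty c).to_subtype
  obtain ⟨g⟩ : Nonempty (compVerts _ c ↪ Fin 5) :=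
    Function.Embedding.nonempty_of_card_le (by simp; omega)
  have hsurj : Function.Surjective (Function.invFun g) := Function.invFun_surjective g.injective
  let e : Fin 5 → F := fun i =>
    ((Function.invFun g i : compVerts _ c) : F)
  refine ⟨e, fun i => (Function.invFun g i).2, ?_⟩
  obtain ⟨k, hk1, hk⟩ := exists_affine_combination_inner_eq (Finset.univ : Finset (Fin 5))
    Finset.univ_nonempty (fun i => shifted z (e i))
  refine ⟨k, hk1, ?_⟩
  by_contra hne
  refine absurd hc (not_lt.2 (two_mul_card_le_of_inner_const hF
    (p := ∑ i, k i • shifted z (e i)) (fun h => hne (inner_self_eq_zero.1 h))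
    (fun A _ B _ => hz.gram A B) fun A hA => ?_))
  obtain ⟨i, hi⟩ := hsurj ⟨A, hA⟩
  have : e i = A := congrArg Subtype.val hi
  rw [← this]
  exact hk i (Finset.mem_univ i)

/-- If an exceptional component is not flat, then its linear relations are determined by at most
three differences of coordinates at which `z` takes equal values. These form a system with
coefficients in `{-1, 0, 1}`, so that the nonzero values of `z` are bounded away from zero. -/
theorem le_abs_of_not_isFlat {ε : ℝ} (hε : IsGap ε) (hF : IsAlmostFisher 2 l F)
    (hz : IsIsotropic l F z) (hc : IsExceptional z c)
    (hflat : ¬ IsFlat z c) (x : α) : z x = 0 ∨ ε ≤ |z x| := by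
  obtain ⟨hr, e, he, k, hk1, hk⟩ := exists_enumeration hF hz hc
  let κ : Type _ := {p : α × α // z p.1 = z p.2}
  let π : α → EuclideanSpace ℝ α →ₗ[ℝ] ℝ := fun x =>
    (EuclideanSpace.proj x : EuclideanSpace ℝ α →L[ℝ] ℝ).toLinearMap
  have hπ : ∀ x f, π x f = f x := fun x f => rfl
  let ψ : κ → EuclideanSpace ℝ α →ₗ[ℝ] ℝ := fun p => π p.1.1 - π p.1.2
  have hψ : ∀ p f, ψ p f = f p.1.1 - f p.1.2 := fun p f => rfl
  have : Nonempty κ := ⟨⟨(x, x), rfl⟩⟩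
  obtain ⟨P, hP⟩ := exists_separating_fin ψ 3 (compSpan z c) (fun f hf hf0 => by
    by_contra hne
    refine hflat ⟨f, hf, hne, fun x x' hxx => ?_⟩
    have := hf0 ⟨(x, x'), hxx⟩
    rw [hψ] at this
    exact sub_eq_zero.1 this) hr
  have hmem : ∀ k : Fin 5 → ℝ, ∑ i, k i • shifted z (e i) ∈ compSpan z c := fun k =>
    Submodule.sum_mem _ fun i _ => Submodule.smul_mem _ _ (shifted_mem_compSpan (he i))
  have hsys : ∀ k : Fin 5 → ℝ, ∑ i, k i • shifted z (e i) = 0 ↔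
      ∀ t, ∑ i, k i * ψ (P t) (shifted z (e i)) = 0 := by
    intro k
    have hcalc : ∀ t, ψ (P t) (∑ i, k i • shifted z (e i)) =
        ∑ i, k i * ψ (P t) (shifted z (e i)) := fun t => by
      simp only [map_sum, map_smul, smul_eq_mul]
    constructor
    · intro h t
      rw [← hcalc, h, map_zero]
    · intro h
      refine hP _ (hmem k) fun t => ?_
      rw [hcalc, h]
  obtain ⟨k', ⟨hk1', hk'⟩, hS⟩ := hε (fun i t => ψ (P t) (shifted z (e i))) (fun i t => by
    rw [hψ]
    have := (P t).2
    simp only [shifted, PiLp.sub_apply, this, sub_sub_sub_cancel_right, charVec_apply]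
    split_ifs <;> simp) ⟨k, hk1, (hsys k).1 hk⟩
  have hzx := eq_sum_charVec hk1' ((hsys k').2 hk') x
  simp only [charVec_apply, mul_ite, mul_one, mul_zero, ← Finset.sum_filter] at hzx
  rw [hzx]
  exact hS _

/-- The number of exceptional components is bounded linearly in `l`. Pick in each of them a nonzero
vector: a function of `z` if all are flat, and otherwise a vector supported on the support of `z`.
These vectors are orthogonal, and lie in a space of dimension at most `32` in the first case, at
most the size of the support of `z` in the second case. -/
theorem card_exceptional_le {ε : ℝ} (hε0 : 0 < ε) (hε : IsGap ε) (hF : IsAlmostFisher 2 l F)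
    (hz : IsIsotropic l F z) (h0 : ∀ A : F, shifted z A ≠ 0)
    (s : Finset (fisherGraph l F).ConnectedComponent) (hs : ∀ c ∈ s, IsExceptional z c) :
    (s.card : ℝ) ≤ 32 + l / ε ^ 2 := by
  classical
  have hnn : 0 ≤ l / ε ^ 2 := by positivity
  by_cases hflat : ∀ c ∈ s, IsFlat z c
  · rcases s.eq_empty_or_nonempty with rfl | ⟨c₁, hc₁⟩
    · simp
      positivity
    obtain ⟨-, e, -, k, hk1, hk⟩ := exists_enumeration hF hz (hs c₁ hc₁)
    let pat : α → Fin 5 → Bool := fun x i => decide (x ∈ (e i : Finset α))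
    have hpat : ∀ x x', pat x = pat x' → z x = z x' := by
      intro x x' h
      rw [eq_sum_charVec hk1 hk x, eq_sum_charVec hk1 hk x']
      refine Finset.sum_congr rfl fun i _ => ?_
      have : (x ∈ (e i : Finset α)) ↔ x' ∈ (e i : Finset α) := by
        simpa [pat] using congrFun h i
      simp only [charVec_apply, this]
    let U : Submodule ℝ (EuclideanSpace ℝ α) :=
      { carrier := {f | ∀ x x', z x = z x' → f x = f x'}
        add_mem' := fun {f g} hf hg x x' h => by
          simp only [PiLp.add_apply, hf x x' h, hg x x' h]
        zero_mem' := fun _ _ _ => rfl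
        smul_mem' := fun a f hf x x' h => by
          simp only [PiLp.smul_apply, hf x x' h] }
    choose! f hfE hfne hf using hflat
    have hcard := card_le_finrank_of_orthogonal s f hfne (fun a ha b hb hab =>
      (compSpan_isOrtho hz hab).inner_eq (hfE a ha) (hfE b hb)) U hf
    have : Nonempty α := by
      by_contra hα
      rw [not_nonempty_iff] at hα
      exact hfne c₁ hc₁ (by ext x; exact hα.elim x)
    have hU := finrank_le_card_of_eq_zero U (Function.invFun pat) fun f hf hfx => by
      ext x
      rw [PiLp.zero_apply, ← hfx (pat x)]
      exact hf _ _ (hpat _ _ (Function.invFun_eq ⟨x, rfl⟩).symm)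
    have h32 : Fintype.card (Fin 5 → Bool) = 32 := by simp
    have : s.card ≤ 32 := by omega
    have : (s.card : ℝ) ≤ 32 := by exact_mod_cast this
    linarith
  · push Not at hflat
    obtain ⟨c₁, hc₁, hnf⟩ := hflat
    have hgap := le_abs_of_not_isFlat hε hF hz (hs c₁ hc₁) hnf
    let T : Finset α := Finset.univ.filter fun x => z x ≠ 0
    have hT : (T.card : ℝ) * ε ^ 2 ≤ l := by
      rw [← hz.self, PiLp.inner_apply]
      calc (T.card : ℝ) * ε ^ 2 = ∑ x ∈ T, ε ^ 2 := by simp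
        _ ≤ ∑ x ∈ T, inner ℝ (z x) (z x) := by
            refine Finset.sum_le_sum fun x hx => ?_
            have h1 := (hgap x).resolve_left (Finset.mem_filter.1 hx).2
            have h2 : ε ^ 2 ≤ |z x| ^ 2 := pow_le_pow_left₀ hε0.le h1 2
            rw [sq_abs] at h2
            simpa [sq] using h2
        _ ≤ ∑ x, inner ℝ (z x) (z x) :=
            Finset.sum_le_sum_of_subset_of_nonneg (Finset.subset_univ T)
              fun x _ _ => real_inner_self_nonneg
    let U : Submodule ℝ (EuclideanSpace ℝ α) :=
      { carrier := {f | ∀ x, z x = 0 → f x = 0}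
        add_mem' := fun {f g} hf hg x h => by
          simp only [PiLp.add_apply, hf x h, hg x h, add_zero]
        zero_mem' := fun _ _ => rfl
        smul_mem' := fun a f hf x h => by
          simp only [PiLp.smul_apply, hf x h, smul_zero] }
    have hex := fun c (hc : c ∈ s) => exists_mem_compSpan_vanishing hF hz h0 (hs c hc)
    choose! f hfE hfne hf using hex
    have hcard := card_le_finrank_of_orthogonal s f hfne (fun a ha b hb hab =>
      (compSpan_isOrtho hz hab).inner_eq (hfE a ha) (hfE b hb)) U hf
    have hU := finrank_le_card_of_eq_zero U (fun x : T => (x : α)) fun f hf hfx => by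
      ext x
      by_cases hx : z x = 0
      · exact hf x hx
      · exact hfx ⟨x, Finset.mem_filter.2 ⟨Finset.mem_univ x, hx⟩⟩
    rw [Fintype.card_coe] at hU
    have h1 : (s.card : ℝ) ≤ T.card := by exact_mod_cast hcard.trans hU
    have h2 : (T.card : ℝ) ≤ l / ε ^ 2 := (le_div_iff₀ (by positivity)).2 hT
    linarith

theorem two_mul_card_le_add_of_isotropic {ε : ℝ} (hε0 : 0 < ε) (hε : IsGap ε)
    (hF : IsAlmostFisher 2 l F) (hz : IsIsotropic l F z) (h0 : ∀ A : F, shifted z A ≠ 0) :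
    2 * (F.card : ℝ) ≤ 3 * Fintype.card α + 4 * (32 + l / ε ^ 2) := by
  classical
  have hsum : ∑ c ∈ comps (fisherGraph l F), Module.finrank ℝ (compSpan z c) ≤
      Fintype.card α := by
    have := sum_finrank_comps_le (supportedOn_excess l F) (y := shifted z)
      (comps (fisherGraph l F)) (fun c _ d _ A _ B _ => hz.gram A B) ⊤
      (fun _ _ _ _ => Submodule.mem_top)
    rwa [finrank_top, finrank_euclideanSpace] at this
  have hm := card_eq_sum_comps (fisherGraph l F)
  rw [Fintype.card_coe] at hm
  have hex := card_exceptional_le hε0 hε hF hz h0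
    ((comps (fisherGraph l F)).filter fun c => IsExceptional z c)
    fun c hc => (Finset.mem_filter.1 hc).2
  have hle : ∀ c ∈ comps (fisherGraph l F), 2 * (compVerts _ c).card ≤
      3 * Module.finrank ℝ (compSpan z c) + 4 * (if IsExceptional z c then 1 else 0) := by
    intro c _
    split_ifs with h
    · have := card_comp_le hF hz c
      omega
    · exact not_lt.1 h
  have hle' := Finset.sum_le_sum hle
  rw [← Finset.mul_sum, Finset.sum_add_distrib, ← Finset.mul_sum, ← Finset.mul_sum,
    ← Finset.card_filter, ← hm] at hle'
  have h1 : 2 * F.card ≤ 3 * Fintype.card α +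
      4 * ((comps (fisherGraph l F)).filter fun c => IsExceptional z c).card := by omega
  have h2 : 2 * (F.card : ℝ) ≤ 3 * Fintype.card α +
      4 * (((comps (fisherGraph l F)).filter fun c => IsExceptional z c).card : ℝ) := by
    exact_mod_cast h1
  linarith

end Exceptional

/-! ### Two-almost Fisher families -/

section TwoAlmost

variable {α : Type*} [Fintype α] [DecidableEq α] {l : ℕ} {F : Finset (Finset α)}

theorem two_mul_card_le_or_isotropic (hF : IsAlmostFisher 2 l F) :
    2 * F.card ≤ 3 * Fintype.card α + 7 ∨ ∃ z : EuclideanSpace ℝ α, IsIsotropic l F z ∧ z ≠ 0 ∧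
      ∀ A : F, shifted z A ≠ 0 := by
  rcases two_mul_card_le_or_exists_isotropic hF with h | ⟨z, hzz, hzA⟩
  · exact Or.inl h
  have hz : IsIsotropic l F z := ⟨hzz, hzA⟩
  by_cases h01 : z = 0 ∨ ∃ A : F, z = charVec (A : Finset α)
  · left
    have := two_mul_card_le_of_isotropic_zero_one hF hz h01
    omega
  · right
    push Not at h01
    exact ⟨z, hz, h01.1, fun A h => h01.2 A (sub_eq_zero.1 h).symm⟩

theorem card_add_two_le (hF : IsAlmostFisher 2 l F) (hn : 11 ≤ Fintype.card α) :
    F.card + 2 ≤ 2 * Fintype.card α := by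
  rcases two_mul_card_le_or_isotropic hF with h | ⟨z, hz, hz0, h0⟩
  · omega
  · exact card_le_of_isotropic hF hz hz0 h0

theorem two_mul_card_le_add {ε : ℝ} (hε0 : 0 < ε) (hε : IsGap ε) (hF : IsAlmostFisher 2 l F) :
    2 * (F.card : ℝ) ≤ 3 * Fintype.card α + 4 * (32 + l / ε ^ 2) := by
  rcases two_mul_card_le_or_isotropic hF with h | ⟨z, hz, -, h0⟩
  · have h' : 2 * (F.card : ℝ) ≤ 3 * Fintype.card α + 7 := by exact_mod_cast h
    have : 0 ≤ l / ε ^ 2 := by positivity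
    linarith
  · exact two_mul_card_le_add_of_isotropic hε0 hε hF hz h0

end TwoAlmost

/-! ### Partition into two-almost Fisher families -/

/-- Lovász's partition lemma: a graph of maximum degree at most `k < 3 t` has a colouring with `t`
colours in which every vertex has at most two neighbours of its own colour. A colouring with the
fewest monochromatic edges has this property. -/
theorem exists_coloring_card_le_two {β : Type*} [Fintype β] (G : SimpleGraph β)
    [DecidableRel G.Adj] {k t : ℕ} (hkt : k < 3 * t)
    (hdeg : ∀ a, (Finset.univ.filter fun b => G.Adj a b).card ≤ k) :
    ∃ χ : β → Fin t, ∀ a, (Finset.univ.filter fun b => G.Adj a b ∧ χ b = χ a).card ≤ 2 := by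
  classical
  have : Nonempty (Fin t) := ⟨⟨0, by omega⟩⟩
  let m : (β → Fin t) → β → β → ℕ := fun χ a b => if G.Adj a b ∧ χ b = χ a then 1 else 0
  have hm : ∀ χ a b, m χ a b = m χ b a := by
    intro χ a b
    simp only [m, G.adj_comm a b, eq_comm (a := χ a)]
  obtain ⟨χ, -, hχ⟩ := Finset.exists_min_image (Finset.univ : Finset (β → Fin t))
    (fun χ => ∑ a, ∑ b, m χ a b) Finset.univ_nonempty
  refine ⟨χ, fun a => ?_⟩
  by_contra! hlt
  -- some colour occurs at most twice among the neighbours of `a`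
  obtain ⟨s, hs⟩ : ∃ s : Fin t, (Finset.univ.filter fun b => G.Adj a b ∧ χ b = s).card ≤ 2 := by
    by_contra! h
    have h1 := Finset.card_eq_sum_card_fiberwise (f := χ)
      (s := Finset.univ.filter fun b => G.Adj a b) (t := Finset.univ)
      (fun _ _ => Finset.mem_coe.2 (Finset.mem_univ _))
    have h2 : ∑ s : Fin t, 3 ≤ ∑ s : Fin t,
        ((Finset.univ.filter fun b => G.Adj a b).filter fun b => χ b = s).card := by
      refine Finset.sum_le_sum fun s _ => ?_
      rw [Finset.filter_filter]
      exact h s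
    rw [← h1] at h2
    simp only [Finset.sum_const, Finset.card_univ, Fintype.card_fin, smul_eq_mul] at h2
    have := hdeg a
    omega
  have hsplit : ∀ χ : β → Fin t, ∑ x, ∑ b, m χ x b = 2 * ∑ b, m χ a b +
      ∑ x ∈ Finset.univ.erase a, ∑ b ∈ Finset.univ.erase a, m χ x b := by
    intro χ
    have haa : m χ a a = 0 := by simp [m]
    have h1 : ∀ x, ∑ b, m χ x b = m χ a x + ∑ b ∈ Finset.univ.erase a, m χ x b := by
      intro x
      rw [← Finset.add_sum_erase _ _ (Finset.mem_univ a), hm χ x a]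
    rw [← Finset.add_sum_erase _ _ (Finset.mem_univ a), Finset.sum_congr rfl fun x _ => h1 x,
      Finset.sum_add_distrib, ← Finset.add_sum_erase Finset.univ (m χ a) (Finset.mem_univ a), haa]
    ring
  have hle := hχ (Function.update χ a s) (Finset.mem_univ _)
  rw [hsplit, hsplit] at hle
  have hrest : ∑ x ∈ Finset.univ.erase a, ∑ b ∈ Finset.univ.erase a, m (Function.update χ a s) x b =
      ∑ x ∈ Finset.univ.erase a, ∑ b ∈ Finset.univ.erase a, m χ x b := by
    refine Finset.sum_congr rfl fun x hx => Finset.sum_congr rfl fun b hb => ?_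
    simp only [m, Function.update_of_ne (Finset.ne_of_mem_erase hx),
      Function.update_of_ne (Finset.ne_of_mem_erase hb)]
  have hold : ∑ b, m χ a b = (Finset.univ.filter fun b => G.Adj a b ∧ χ b = χ a).card := by
    simp [m]
  have hnew : ∑ b, m (Function.update χ a s) a b =
      (Finset.univ.filter fun b => G.Adj a b ∧ χ b = s).card := by
    rw [Finset.card_filter]
    refine Finset.sum_congr rfl fun b _ => ?_
    by_cases hb : G.Adj a b
    · simp [m, Function.update_of_ne hb.ne']
    · simp [m, hb]
  omega

/-- A bound for two-almost Fisher families yields one for `k`-almost Fisher families, at the cost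
of a factor `t > k / 3`. -/
theorem card_le_mul_of_two {α : Type*} [DecidableEq α] {k l t N : ℕ} (hkt : k < 3 * t)
    (h2 : ∀ F : Finset (Finset α), IsAlmostFisher 2 l F → F.card ≤ N)
    {F : Finset (Finset α)} (hF : IsAlmostFisher k l F) : F.card ≤ t * N := by
  classical
  obtain ⟨χ, hχ⟩ := exists_coloring_card_le_two (fisherGraph l F) hkt fun A => by
    refine le_trans ?_ (hF A.1 A.2)
    rw [← Finset.card_map (Function.Embedding.subtype _)]
    refine Finset.card_le_card fun B hB => ?_
    simp only [Finset.mem_map, Finset.mem_filter, Finset.mem_univ, true_and] at hB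
    obtain ⟨B', hB', rfl⟩ := hB
    exact Finset.mem_filter.2 ⟨B'.2, fun h => hB'.1 (Subtype.ext h.symm), hB'.2⟩
  have hcol : ∀ s : Fin t, (Finset.univ.filter fun A => χ A = s).card ≤ N := by
    intro s
    rw [← Finset.card_map (Function.Embedding.subtype _)]
    apply h2
    intro A hA
    simp only [Finset.mem_map, Finset.mem_filter, Finset.mem_univ, true_and] at hA
    obtain ⟨A', hA', rfl⟩ := hA
    refine le_trans ?_ (hχ A')
    rw [← Finset.card_map (Function.Embedding.subtype _)
      (s := Finset.univ.filter fun b => (fisherGraph l F).Adj A' b ∧ χ b = χ A')]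
    refine Finset.card_le_card fun B hB => ?_
    simp only [Finset.mem_map, Finset.mem_filter, Finset.mem_univ, true_and] at hB ⊢
    obtain ⟨⟨B', hB', rfl⟩, hne, hint⟩ := hB
    exact ⟨B', ⟨⟨fun h => hne (congrArg Subtype.val h.symm), hint⟩, hB'.trans hA'.symm⟩, rfl⟩
  have h1 := Finset.card_eq_sum_card_fiberwise (f := χ) (s := Finset.univ) (t := Finset.univ)
    (fun _ _ => Finset.mem_coe.2 (Finset.mem_univ _))
  rw [Finset.card_univ, Fintype.card_coe] at h1
  rw [h1]
  refine (Finset.sum_le_sum fun s _ => hcol s).trans ?_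
  simp

theorem lt_three_mul_toNat_ceil (k : ℕ) : k < 3 * ⌈((k : ℝ) + 1) / 3⌉.toNat := by
  have h := Int.le_ceil (((k : ℝ) + 1) / 3)
  have h2 : ((k + 1 : ℤ) : ℝ) ≤ ((3 * ⌈((k : ℝ) + 1) / 3⌉ : ℤ) : ℝ) := by
    push_cast
    linarith
  have h3 : (k : ℤ) + 1 ≤ 3 * ⌈((k : ℝ) + 1) / 3⌉ := by exact_mod_cast h2
  omega

theorem almostFisherMax_le {n l : ℕ} (k : ℕ) {b : ℝ}
    (h2 : ∀ F : Finset (Finset (Fin n)), IsAlmostFisher 2 l F → (F.card : ℝ) ≤ b) :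
    (almostFisherMax n k l : ℝ) ≤ b * (⌈((k : ℝ) + 1) / 3⌉ : ℝ) := by
  obtain ⟨F, hF, hcard⟩ := (almostFisherMax_isGreatest n k l).1
  have hlt := lt_three_mul_toNat_ceil k
  have hpos : 0 ≤ ⌈((k : ℝ) + 1) / 3⌉ := by omega
  have hb : 0 ≤ b := by simpa using h2 ∅ (by simp [IsAlmostFisher])
  have h := card_le_mul_of_two hlt (fun F hF => Nat.le_floor (h2 F hF)) hF
  rw [← hcard]
  have hcast : ((⌈((k : ℝ) + 1) / 3⌉.toNat : ℕ) : ℝ) = (⌈((k : ℝ) + 1) / 3⌉ : ℝ) := by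
    exact_mod_cast congrArg (Int.cast (R := ℝ)) (Int.toNat_of_nonneg hpos)
  calc (F.card : ℝ) ≤ ((⌈((k : ℝ) + 1) / 3⌉.toNat * ⌊b⌋₊ : ℕ) : ℝ) := by exact_mod_cast h
    _ = ⌊b⌋₊ * (⌈((k : ℝ) + 1) / 3⌉ : ℝ) := by
        push_cast [hcast]
        ring
    _ ≤ _ := by
        gcongr
        exact Nat.floor_le hb

theorem corollary1p7 :
    (∃ N : ℕ, ∀ n : ℕ, N ≤ n → ∀ k : ℕ, 1 ≤ k → ∀ l : ℕ,
      (almostFisherMax n k l : ℝ) ≤ (2 * (n : ℝ) - 2) * (⌈((k : ℝ) + 1) / 3⌉ : ℝ)) ∧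
    (∀ l : ℕ → ℕ, (fun n : ℕ => (l n : ℝ)) =o[atTop] (fun n : ℕ => (n : ℝ)) →
      ∃ e : ℕ → ℝ, Tendsto e atTop (𝓝 0) ∧
        ∀ᶠ n : ℕ in atTop, ∀ k : ℕ, 1 ≤ k →
          (almostFisherMax n k (l n) : ℝ)
            ≤ (3 / 2 + e n) * (n : ℝ) * (⌈((k : ℝ) + 1) / 3⌉ : ℝ)) := by
  constructor
  · refine ⟨11, fun n hn k _ l => almostFisherMax_le k fun F hF => ?_⟩
    have h := card_add_two_le hF (by simpa using hn)
    rw [Fintype.card_fin] at h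
    have : (F.card : ℝ) + 2 ≤ 2 * n := by exact_mod_cast h
    linarith
  · intro l hl
    obtain ⟨ε, hε0, hε⟩ := exists_isGap
    refine ⟨fun n => 64 * (1 / (n : ℝ)) + 2 / ε ^ 2 * ((l n : ℝ) / n), ?_, ?_⟩
    · have h1 := tendsto_one_div_atTop_nhds_zero_nat (𝕜 := ℝ)
      have h2 := hl.tendsto_div_nhds_zero
      simpa using (h1.const_mul 64).add (h2.const_mul (2 / ε ^ 2))
    · filter_upwards [eventually_gt_atTop 0] with n hn k _
      refine almostFisherMax_le k fun F hF => ?_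
      have h := two_mul_card_le_add hε0 hε hF
      rw [Fintype.card_fin] at h
      have hn' : (n : ℝ) ≠ 0 := by positivity
      have : (3 / 2 + (64 * (1 / (n : ℝ)) + 2 / ε ^ 2 * ((l n : ℝ) / n))) * (n : ℝ) =
          3 / 2 * n + 2 * (32 + l n / ε ^ 2) := by
        field_simp
        ring
      linarith
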